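/- Let $k$ be an infinite field, let $S=k[x_0,\dots,x_n]$ be a polynomial ring with homogeneous maximal ideal $\mathfrak m=(x_0,\dots,x_n)$, and let $I\subset S$ be an ideal of codimension (height) at least $2$ that is generated by a $k$-vector space $W$ of forms of the same degree. Let $\ell(I)=\dim S[It]/\mathfrak m S[It]$ be the analytic spread of $I$; equivalently, $\ell(I)$ is one plus the dimension of the image of the rational map $\mathbf P^n \dashrightarrow \mathbf P(W)$ defined by $W$. A homogeneous presentation matrix of an ideal $J$ generated by forms is a matrix $A$ of a homogeneous free presentation $F\to G\to J\to 0$ in which the basis of $G$ maps to a minimal set of homogeneous generators of $J$ (rows correspond to generators of $J$, columns to homogeneous syzygies generating the syzygy module). The row ideals of $A$ are the ideals generated by the entries of the individual rows of $A$. When the generators have the same degree, the generalized row ideals of $A$ are the ideals generated by the entries of the individual nonzero $k$-linear combinations of the rows of $A$ (that is, combinations with coefficients in $k$, not all zero). An ideal is called linear if it is generated by linear forms (the zero ideal is allowed). Suppose that $I$ has a homogeneous presentation matrix all of whose entries are linear forms or zero, or merely that all generalized row ideals of a homogeneous presentation matrix of $I$ are linear. Then for every $d\ge 1$ the ideal $I^d$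 has a homogeneous presentation matrix all of whose row ideals are linear of codimension $\ell(I)-1$. -/

import Mathlib

namespace RowIdeals

open MvPolynomial

variable {k : Type*} [Field k] {n : ℕ}

/-- An ideal of `k[x₀,…,xₙ]` is linear if it is generated by linear forms
(the zero ideal, generated by the empty set, is linear). -/
def IsLinearIdeal (J : Ideal (MvPolynomial (Fin (n + 1)) k)) : Prop :=
  ∃ T : Set (MvPolynomial (Fin (n + 1)) k),
    (∀ f ∈ T, f.IsHomogeneous 1) ∧ J = Ideal.span T

/-- `A` is a homogeneous presentation matrix of the ideal `I` with respect to the homogeneous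
minimal generating set `g₀,…`: rows correspond to generators, columns to generating syzygies.
That is, `F → G → I → 0` is exact, where `G` is free on the `g i`, the map `F → G` is given by
`A`, and all maps are homogeneous of degree `0` for a suitable grading of the free module `F`. -/
structure IsHomogeneousPresentation (I : Ideal (MvPolynomial (Fin (n + 1)) k)) {m c : ℕ}
    (g : Fin m → MvPolynomial (Fin (n + 1)) k)
    (A : Matrix (Fin m) (Fin c) (MvPolynomial (Fin (n + 1)) k)) : Prop where
  /-- The `g i` generate `I`. -/
  span_eq : Ideal.span (Set.range g) = I
  /-- No generator can be omitted. -/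
  minimal : ∀ i, g i ∉ Ideal.span (g '' {j | j ≠ i})
  /-- The generators are forms, and the `j`-th column is homogeneous of some degree `b j`:
  its `i`-th entry is zero or a form of degree `b j - a i`, where `a i` is the degree of `g i`. -/
  homogeneous : ∃ (a : Fin m → ℕ) (b : Fin c → ℕ), (∀ i, (g i).IsHomogeneous (a i)) ∧
    ∀ i j, A i j ≠ 0 → ∃ e : ℕ, a i + e = b j ∧ (A i j).IsHomogeneous e
  /-- The columns of `A` generate the module of syzygies of `g`. -/
  exact : ∀ v : Fin m → MvPolynomial (Fin (n + 1)) k,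
    ∑ i, v i * g i = 0 ↔
      v ∈ Submodule.span (MvPolynomial (Fin (n + 1)) k) (Set.range fun j i => A i j)

/-- The row ideal of the `i`-th row: the ideal generated by the entries of the row. -/
noncomputable def rowIdeal {m c : ℕ} (A : Matrix (Fin m) (Fin c) (MvPolynomial (Fin (n + 1)) k)) (i : Fin m) :
    Ideal (MvPolynomial (Fin (n + 1)) k) :=
  Ideal.span (Set.range (A i))

/-- The ideal generated by the entries of the `k`-linear combination of the rows of `A` with
coefficients `q`. If `A` is a presentation matrix with respect to a basis `g` of `W`, a nonzero
`q` is a nonzero functional `g i ↦ q i` on `W`, i.e. (up to scalars) a codimension one subspace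
`W_q` of `W`, namely its kernel; the combination is then the matrix of the composite
`F → S ⊗ W → S ⊗ (W / W_q) ≅ S`, the generalized row corresponding to the point `q`. -/
noncomputable def generalizedRowIdeal {m c : ℕ}
    (A : Matrix (Fin m) (Fin c) (MvPolynomial (Fin (n + 1)) k)) (q : Fin m → k) :
    Ideal (MvPolynomial (Fin (n + 1)) k) :=
  Ideal.span (Set.range fun j => ∑ i, C (q i) * A i j)

/-- `I` has a homogeneous presentation matrix all of whose entries are linear forms (or zero). -/
def IsLinearlyPresented (I : Ideal (MvPolynomial (Fin (n + 1)) k)) : Prop :=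
  ∃ (m c : ℕ) (g : Fin m → MvPolynomial (Fin (n + 1)) k)
    (A : Matrix (Fin m) (Fin c) (MvPolynomial (Fin (n + 1)) k)),
    IsHomogeneousPresentation I g A ∧ ∀ i j, (A i j).IsHomogeneous 1

/-- All generalized row ideals of a homogeneous presentation matrix of `I` (an ideal generated by
forms of one degree) are linear. -/
def HasLinearGeneralizedRowIdeals (I : Ideal (MvPolynomial (Fin (n + 1)) k)) : Prop :=
  ∃ (m c : ℕ) (g : Fin m → MvPolynomial (Fin (n + 1)) k)
    (A : Matrix (Fin m) (Fin c) (MvPolynomial (Fin (n + 1)) k)),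
    IsHomogeneousPresentation I g A ∧
      ∀ q : Fin m → k, q ≠ 0 → IsLinearIdeal (generalizedRowIdeal A q)

/-- The analytic spread `ℓ(I)`: the Krull dimension of the special fiber ring `R / 𝔪R`, where
`R = S[It]` is the Rees algebra of `I` and `𝔪 = (x₀,…,xₙ)`. When `I` is generated by a space `W`
of forms of the same degree, `R / 𝔪R` is the homogeneous coordinate ring of the closed image of
the rational map `ℙⁿ ⇢ ℙ(W)`, so that `ℓ(I)` is one plus the dimension of that image. -/
noncomputable def analyticSpread (I : Ideal (MvPolynomial (Fin (n + 1)) k)) : WithBot ℕ∞ :=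
  ringKrullDim (reesAlgebra I ⧸
    (Ideal.span (Set.range (X : Fin (n + 1) → MvPolynomial (Fin (n + 1)) k))).map
      (algebraMap (MvPolynomial (Fin (n + 1)) k) (reesAlgebra I)))

end RowIdeals

namespace RowIdeals
open MvPolynomial

/-! ### Krull dimension and transcendence degree -/

/-! Fix a point `p` where the generators `g i` of `I` do not all vanish; let `V` be their `k`-span
and `V_p` the space of forms of `V` vanishing at `p`. The generalized row ideal `J` with
coefficients `g i (p)` is the colon ideal `(V_p) : V`. It contains `V_p` by Koszul syzygies, all its
elements vanish at `p`, and being linear it is prime. Modulo `J` every form of `V` is its value at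
`p` times one fixed form, so the forms of `V ^ d` vanishing at `p` lie in `J`; primality then gives
`((V ^ d)_p) : b = J` for every `b ∈ V ^ d` with `b(p) = 1` (`mem_generalizedRowIdeal_iff_mul_mem`).

A row ideal of any presentation is the colon of the remaining generators by the given one
(`mem_rowIdeal_iff`). Over an infinite field `V ^ d` has a basis dual to evaluation at points
outside a given hypersurface (`exists_dual_points`). With this basis as generators of `I ^ d`, each
row ideal is the linear ideal `J` of one of the points.

For the codimension, the zero set of `J` is a linear space, the closure of the fibre of the rational
map through `p`, so for general `p` its codimension is the dimension of the image. Algebraically,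
the special fibre ring is `k[g i * t]` (`ringKrullDim_fiber`), whose dimension is its transcendence
degree, and the height of `J` is the rank at `p` of a matrix `Ψ` of linear parts.
`exists_generic_rank` shows that the transcendence degree is the generic rank `r` plus one, using an
`r`-dimensional affine slice `p₀ + E y` transversal to a fibre. The coordinates on the slice are
algebraic over the restricted `g i * t`, which bounds the degree below; the fibre through a general
point meets the slice in a point given by Cramer's rule, which bounds it above. -/

theorem ringKrullDim_le_of_isIntegral (A B : Type*) [CommRing A] [CommRing B] [Algebra A B]
    [Algebra.IsIntegral A B] : ringKrullDim B ≤ ringKrullDim A :=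
  Order.krullDim_le_of_strictMono (PrimeSpectrum.comap (algebraMap A B)) fun P Q h => by
    have h' : P.asIdeal < Q.asIdeal := h
    exact Ideal.IsIntegral.comap_lt_comap (R := A) h'

/-- Lying over gives a prime above the bottom of a chain in `A`, and going up lifts the rest of the
chain. -/
theorem ringKrullDim_le_of_isIntegral_of_injective (A B : Type*) [CommRing A] [CommRing B]
    [Algebra A B] [Algebra.IsIntegral A B] [FaithfulSMul A B] :
    ringKrullDim A ≤ ringKrullDim B := by
  refine iSup_le fun l => ?_
  obtain ⟨⟨P, hP, hPl⟩⟩ := Ideal.nonempty_primesOver (S := B) l.head.asIdeal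
  obtain ⟨L, hL, -⟩ := Ideal.exists_ltSeries_of_hasGoingUp l P
  rw [← hL]
  exact le_iSup (fun p : LTSeries (PrimeSpectrum B) => ((p.length : ℕ∞) : WithBot ℕ∞)) L

/-- Noether normalization: an integral extension of a polynomial ring in `s` variables has the same
dimension and the same transcendence degree as that ring. -/
theorem exists_ringKrullDim_eq_trdeg (k B : Type*) [Field k] [CommRing B] [IsDomain B]
    [Algebra k B] [Algebra.FiniteType k B] :
    ∃ s : ℕ, ringKrullDim B = s ∧ Algebra.trdeg k B = s := by
  obtain ⟨s, f, hf, hint⟩ := exists_integral_inj_algHom_of_fg k B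
  refine ⟨s, ?_, ?_⟩
  · let _ := f.toRingHom.toAlgebra
    have : Algebra.IsIntegral (MvPolynomial (Fin s) k) B := ⟨hint⟩
    have : FaithfulSMul (MvPolynomial (Fin s) k) B :=
      (faithfulSMul_iff_algebraMap_injective _ _).2 hf
    rw [(ringKrullDim_le_of_isIntegral (MvPolynomial (Fin s) k) B).antisymm
      (ringKrullDim_le_of_isIntegral_of_injective (MvPolynomial (Fin s) k) B),
      MvPolynomial.ringKrullDim_of_isNoetherianRing]
    simp
  · let _ := f.toRingHom.toAlgebra
    have : IsScalarTower k (MvPolynomial (Fin s) k) B := .of_algebraMap_eq' f.comp_algebraMap.symm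
    have : Algebra.IsIntegral (MvPolynomial (Fin s) k) B := ⟨hint⟩
    have : FaithfulSMul (MvPolynomial (Fin s) k) B :=
      (faithfulSMul_iff_algebraMap_injective _ _).2 hf
    have h := lift_trdeg_add_eq k (MvPolynomial (Fin s) k) B
    rw [trdeg_eq_zero (R := MvPolynomial (Fin s) k) (A := B)] at h
    simpa using h.symm

/-! ### Ideals generated by linear forms -/

section Coordinates
variable {k : Type*} [Field k] {ι κ : Type*}

/-- Setting the variables of `ι` to zero changes a polynomial only by an element of the ideal they
generate. The target is a domain, which yields primality. -/
theorem span_X_inl_eq_ker :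
    Ideal.span (Set.range fun i : ι => (X (Sum.inl i) : MvPolynomial (ι ⊕ κ) k)) =
    RingHom.ker (aeval (Sum.elim 0 X) : MvPolynomial (ι ⊕ κ) k →ₐ[k] MvPolynomial κ k) := by
  refine le_antisymm (Ideal.span_le.2 ?_) fun f hf => ?_
  · rintro _ ⟨i, rfl⟩
    simp
  · have key : ∀ f : MvPolynomial (ι ⊕ κ) k, f - rename Sum.inr (aeval (Sum.elim 0 X) f :
        MvPolynomial κ k) ∈
        Ideal.span (Set.range fun i : ι => (X (Sum.inl i) : MvPolynomial (ι ⊕ κ) k)) := by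
      intro f
      rw [← Ideal.Quotient.eq]
      change (Ideal.Quotient.mkₐ k _) f = (((Ideal.Quotient.mkₐ k _).comp (rename Sum.inr)).comp
        (aeval (Sum.elim 0 X))) f
      congr 1
      ext i
      rcases i with i | i
      · simp only [Ideal.Quotient.mkₐ_eq_mk, AlgHom.comp_apply, aeval_X, Sum.elim_inl,
          Pi.zero_apply, map_zero]
        exact Ideal.Quotient.eq_zero_iff_mem.2 (Ideal.subset_span ⟨i, rfl⟩)
      · simp
    have := key f
    rwa [show aeval (Sum.elim 0 X) f = (0 : MvPolynomial κ k) from hf, map_zero, sub_zero] at this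

theorem isPrime_span_X_image (s : Set ι) :
    (Ideal.span (X '' s : Set (MvPolynomial ι k))).IsPrime := by
  classical
  let e := renameEquiv k (Equiv.Set.sumCompl s)
  have h : Ideal.span (X '' s : Set (MvPolynomial ι k)) =
      Ideal.map e.toRingEquiv (Ideal.span
        (Set.range fun i : s => (X (Sum.inl i) : MvPolynomial (s ⊕ (sᶜ : Set ι)) k))) := by
    rw [Ideal.map_span, ← Set.range_comp]
    congr 1
    ext f
    simp [e]
  rw [h, span_X_inl_eq_ker]
  have := RingHom.ker_isPrime
    (aeval (Sum.elim 0 X) : MvPolynomial (s ⊕ (sᶜ : Set ι)) k →ₐ[k] MvPolynomial (sᶜ : Set ι) k)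
  exact Ideal.map_isPrime_of_equiv _

/-- Krull's height theorem bounds the height above; adjoining the variables one at a time gives a
strict chain of primes, which bounds it below. -/
theorem height_span_X_image [Finite ι] (s : Finset ι) :
    (Ideal.span (X '' (s : Set ι) : Set (MvPolynomial ι k))).height = s.card := by
  classical
  apply le_antisymm
  · have := isPrime_span_X_image (k := k) (s : Set ι)
    refine (Ideal.height_le_card_of_mem_minimalPrimes_span_finset (s := s.image X) ?_).trans
      (by exact_mod_cast Finset.card_image_le)
    rw [Finset.coe_image, Ideal.minimalPrimes_eq_subsingleton_self]
    rfl
  · induction s using Finset.induction_on with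
    | empty => simp
    | insert a s ha ih =>
      have := isPrime_span_X_image (k := k) (s : Set ι)
      have := isPrime_span_X_image (k := k) ((insert a s : Finset ι) : Set ι)
      have hlt : Ideal.span (X '' (s : Set ι) : Set (MvPolynomial ι k)) <
          Ideal.span (X '' ((insert a s : Finset ι) : Set ι)) := by
        refine lt_of_le_of_ne (Ideal.span_mono (Set.image_mono (by simp))) fun h => ?_
        have hX : (X a : MvPolynomial ι k) ∈ Ideal.span (X '' (s : Set ι)) := by
          rw [h]
          exact Ideal.subset_span ⟨a, by simp, rfl⟩
        rw [mem_ideal_span_X_image] at hX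
        obtain ⟨i, hi, h0⟩ := hX (Finsupp.single a 1) (by simp [support_X])
        rw [Finsupp.single_apply] at h0
        split_ifs at h0 with h1
        · exact ha (h1 ▸ hi)
        · exact h0 rfl
      rw [Finset.card_insert_of_notMem ha]
      rw [Nat.cast_succ]
      exact (add_le_add_left ih 1).trans (Ideal.height_add_one_le_of_lt_of_isPrime hlt)

end Coordinates

section LinearForms
variable {k : Type*} [Field k] {σ : Type*} [Fintype σ]

/-- The linear form with coefficient vector `a`. -/
noncomputable def linForm (k σ : Type*) [Field k] [Fintype σ] : (σ → k) →ₗ[k] MvPolynomial σ k :=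
  ∑ l, (LinearMap.proj l : (σ → k) →ₗ[k] k).smulRight (X l)

theorem linForm_apply (a : σ → k) : linForm k σ a = ∑ l, C (a l) * X l := by
  simp [linForm, smul_eq_C_mul]

theorem eval_linForm (a p : σ → k) : eval p (linForm k σ a) = ∑ l, a l * p l := by
  simp [linForm_apply]

/-- The linear change of coordinates attached to a basis of the space of linear forms. -/
noncomputable def basisEquiv {ι : Type*} (b : Module.Basis ι k (σ → k)) [Fintype ι] :
    MvPolynomial ι k ≃ₐ[k] MvPolynomial σ k :=
  letI := Classical.decEq σ
  AlgEquiv.ofAlgHom (aeval fun i => linForm k σ (b i))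
    (aeval fun l => ∑ i, b.repr (Pi.single l 1) i • X i)
    (by
      ext1 l
      simp only [AlgHom.comp_apply, aeval_X, map_sum, map_smul, AlgHom.id_apply]
      simp only [← map_smul, ← map_sum, b.sum_repr]
      rw [linForm_apply, Finset.sum_eq_single l] <;> simp +contextual)
    (by
      ext1 i
      simp only [AlgHom.comp_apply, aeval_X, linForm_apply, map_sum, map_mul, AlgHom.id_apply]
      have : ∀ l, (aeval fun l => ∑ i, b.repr (Pi.single l 1) i • X i :
          MvPolynomial σ k →ₐ[k] MvPolynomial ι k) (C (b i l)) = C (b i l) := fun l => by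
        simp [algebraMap_eq]
      simp only [this, ← smul_eq_C_mul, Finset.smul_sum, smul_smul]
      rw [Finset.sum_comm]
      simp only [← Finset.sum_smul]
      have h : ∀ j, ∑ l, b i l * b.repr (Pi.single l 1) j = b.repr (b i) j := fun j => by
        conv_rhs => rw [pi_eq_sum_univ' (b i)]
        simp [Finsupp.finsetSum_apply]
      simp only [h, b.repr_self]
      rw [Finset.sum_eq_single i] <;> simp +contextual)

theorem basisEquiv_X {ι : Type*} [Fintype ι] (b : Module.Basis ι k (σ → k)) (i : ι) :
    basisEquiv b (X i) = linForm k σ (b i) := by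
  simp [basisEquiv]

/-- A basis of `V` extended to the whole space is a linear change of coordinates that turns the
ideal into one generated by variables. -/
theorem isPrime_and_height_span_linForm (V : Submodule k (σ → k)) :
    (Ideal.span (linForm k σ '' V)).IsPrime ∧
      (Ideal.span (linForm k σ '' V)).height = Module.finrank k V := by
  classical
  obtain ⟨V', hV'⟩ := V.exists_isCompl
  let bV := Module.finBasis k V
  let b : Module.Basis _ k (σ → k) := (bV.prod (Module.finBasis k V')).map
    (V.prodEquivOfIsCompl V' hV')
  have hb : ∀ i, b (Sum.inl i) = bV i := fun i => by simp [b]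
  let s : Finset (Fin (Module.finrank k V) ⊕ Fin (Module.finrank k V')) :=
    Finset.univ.map .inl
  have h : Ideal.span (linForm k σ '' V) =
      Ideal.map (basisEquiv b).toRingEquiv (Ideal.span (X '' (s : Set _))) := by
    rw [Ideal.map_span, ← Set.image_comp]
    apply le_antisymm
    · rw [Ideal.span_le]
      rintro _ ⟨v, hv, rfl⟩
      have : v = ∑ i, bV.repr ⟨v, hv⟩ i • (bV i : σ → k) := by
        have := congrArg V.subtype (bV.sum_repr ⟨v, hv⟩)
        rw [map_sum] at this
        exact this.symm
      rw [this, map_sum]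
      refine Submodule.sum_mem _ fun i _ => ?_
      rw [map_smul, smul_eq_C_mul]
      refine Ideal.mul_mem_left _ _ (Ideal.subset_span ⟨Sum.inl i, by simp [s], ?_⟩)
      simp [basisEquiv_X, hb]
    · rw [Ideal.span_le]
      rintro _ ⟨i, hi, rfl⟩
      simp only [s, Finset.coe_map, Finset.coe_univ, Set.image_univ, Set.mem_range,
        Function.Embedding.inl_apply] at hi
      obtain ⟨j, rfl⟩ := hi
      refine Ideal.subset_span ⟨bV j, (bV j).2, ?_⟩
      simp [basisEquiv_X, hb]
  rw [h]
  refine ⟨?_, ?_⟩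
  · have := isPrime_span_X_image (k := k) (SetLike.coe s)
    exact Ideal.map_isPrime_of_equiv _
  · rw [RingEquiv.height_map, height_span_X_image]
    simp [s]

end LinearForms

/-! ### Homogeneous components and linear parts of generators. -/

section Homogeneous

attribute [local instance] MvPolynomial.gradedAlgebra

variable {k : Type*} [Field k] {σ : Type*}

theorem homogeneousComponent_mul_of_isHomogeneous (f : MvPolynomial σ k) {g : MvPolynomial σ k}
    {a : ℕ} (hg : g.IsHomogeneous a) (e : ℕ) :
    homogeneousComponent e (f * g) = if a ≤ e then homogeneousComponent (e - a) f * g else 0 := by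
  have := DirectSum.coe_decompose_mul_of_right_mem (homogeneousSubmodule σ k) (a := f) (b := g) e hg
  rw [← decomposition.decompose'_apply, ← decomposition.decompose'_apply]
  exact this

theorem homogeneousComponent_mul_add (f : MvPolynomial σ k) {g : MvPolynomial σ k}
    {a : ℕ} (hg : g.IsHomogeneous a) (e : ℕ) :
    homogeneousComponent (a + e) (f * g) = homogeneousComponent e f * g := by
  rw [homogeneousComponent_mul_of_isHomogeneous f hg, if_pos (by omega), Nat.add_sub_cancel_left]

theorem homogeneousComponent_mul_self (f : MvPolynomial σ k) {g : MvPolynomial σ k}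
    {a : ℕ} (hg : g.IsHomogeneous a) :
    homogeneousComponent a (f * g) = C (coeff 0 f) * g := by
  rw [← homogeneousComponent_zero, ← homogeneousComponent_mul_add f hg 0, add_zero]

theorem eval_smul_of_isHomogeneous {f : MvPolynomial σ k} {a : ℕ} (hf : f.IsHomogeneous a)
    {A : Type*} [CommRing A] [Algebra k A] (c : A) (p : σ → A) :
    aeval (c • p) f = c ^ a * aeval p f := by
  rw [aeval_def, aeval_def, eval₂_eq, eval₂_eq, Finset.mul_sum]
  refine Finset.sum_congr rfl fun d hd => ?_
  have hd' : ∑ i ∈ d.support, d i = a := by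
    have := hf.degree_eq_sum_deg_support hd
    rw [this]
  simp only [Pi.smul_apply, smul_eq_mul, mul_pow, Finset.prod_mul_distrib,
    Finset.prod_pow_eq_pow_sum, hd']
  ring

/-- The vector of coefficients of the linear part of `f`. -/
noncomputable def linCoeff (f : MvPolynomial σ k) (l : σ) : k := coeff (Finsupp.single l 1) f

theorem homogeneousComponent_one_eq_linForm [Fintype σ] (f : MvPolynomial σ k) :
    homogeneousComponent 1 f = linForm k σ (linCoeff f) := by
  classical
  ext d
  rw [coeff_homogeneousComponent, linForm_apply, coeff_sum]
  simp only [coeff_C_mul, coeff_X, linCoeff]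
  split_ifs with h
  · obtain ⟨l, rfl⟩ : ∃ l, d = Finsupp.single l 1 := (Finsupp.sum_eq_one_iff d).1 h
    rw [Finset.sum_eq_single l]
    · simp
    · intro j _ hj
      rw [if_neg, mul_zero]
      intro h
      exact hj (Finsupp.single_left_injective one_ne_zero h)
    · simp
  · rw [Finset.sum_eq_zero]
    intro j _
    rw [if_neg, mul_zero]
    rintro rfl
    simp at h

theorem coeff_zero_of_mem_span_isHomogeneous_one {T : Set (MvPolynomial σ k)}
    (hT : ∀ f ∈ T, f.IsHomogeneous 1) {f : MvPolynomial σ k} (hf : f ∈ Ideal.span T) :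
    coeff 0 f = 0 := by
  have h : Ideal.span T ≤ RingHom.ker (constantCoeff : MvPolynomial σ k →+* k) :=
    Ideal.span_le.2 fun f hf => (hT f hf).coeff_eq_zero (by simp)
  exact h hf

/-- A linear ideal is generated by the linear parts of any system of generators. -/
theorem linear_span_eq_span_linForm [Fintype σ] {T : Set (MvPolynomial σ k)}
    (hT : ∀ f ∈ T, f.IsHomogeneous 1) {F : Set (MvPolynomial σ k)}
    (h : Ideal.span F = Ideal.span T) :
    Ideal.span T = Ideal.span (linForm k σ '' (Submodule.span k (linCoeff '' F))) := by
  have hmem : ∀ f ∈ Ideal.span T, homogeneousComponent 1 f ∈ Ideal.span T := fun f hf => by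
    refine homogeneousComponent_mem_of_mem ?_ hf 1
    exact Ideal.homogeneous_span _ _ fun x hx => ⟨1, hT x hx⟩
  have hc : ∀ f ∈ Ideal.span F, homogeneousComponent 1 f ∈
      Ideal.span (linForm k σ '' (Submodule.span k (linCoeff '' F))) := by
    intro f hf
    induction hf using Submodule.span_induction with
    | mem f hf =>
      rw [homogeneousComponent_one_eq_linForm]
      exact Ideal.subset_span ⟨_, Submodule.subset_span ⟨f, hf, rfl⟩, rfl⟩
    | zero => simp
    | add x y _ _ hx hy => rw [map_add]; exact add_mem hx hy
    | smul a x hx ih =>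
      have h0 : coeff 0 x = 0 := coeff_zero_of_mem_span_isHomogeneous_one hT (h ▸ hx)
      -- Since `x` has no constant term, only the constant term of `a` contributes in degree one.
      have : homogeneousComponent 1 (a • x) = C (coeff 0 a) * homogeneousComponent 1 x := by
        classical
        ext d
        rw [coeff_C_mul, coeff_homogeneousComponent, coeff_homogeneousComponent]
        split_ifs with hd
        · obtain ⟨l, rfl⟩ : ∃ l, d = Finsupp.single l 1 := (Finsupp.sum_eq_one_iff d).1 hd
          rw [smul_eq_mul, coeff_mul, Finsupp.antidiagonal_single]
          simp [Finset.Nat.antidiagonal_succ, h0]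
        · simp
      rw [this]
      exact Ideal.mul_mem_left _ _ ih
  apply le_antisymm
  · rw [Ideal.span_le]
    intro f hf
    rw [SetLike.mem_coe, ← homogeneousComponent_eq_self (hT f hf)]
    exact hc f (h ▸ Ideal.subset_span hf)
  · rw [Ideal.span_le]
    rintro _ ⟨v, hv, rfl⟩
    have : Submodule.span k (linCoeff '' F) ≤
        ((Ideal.span T).restrictScalars k).comap (linForm k σ) := by
      rw [Submodule.span_le]
      rintro _ ⟨f, hf, rfl⟩
      change linForm k σ (linCoeff f) ∈ Ideal.span T
      rw [← homogeneousComponent_one_eq_linForm]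
      exact hmem f (h ▸ Ideal.subset_span hf)
    exact this hv

theorem isPrime_span_of_isHomogeneous_one [Fintype σ] {T : Set (MvPolynomial σ k)}
    (hT : ∀ f ∈ T, f.IsHomogeneous 1) : (Ideal.span T).IsPrime := by
  rw [linear_span_eq_span_linForm hT rfl]
  exact (isPrime_and_height_span_linForm _).1

end Homogeneous

/-! ### Transcendence degree of `k[g i * t]` from linear relations among the forms. -/

section Trdeg
variable {k : Type*} [Field k] {σ κ : Type*}

/-- An algebra that embeds into the subalgebra generated by a finite family has transcendence
degree at most the size of the family. -/
theorem trdeg_le_of_range_subset {k B L τ : Type*} [Field k] [CommRing B] [CommRing L]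
    [IsDomain L] [Algebra k B] [Algebra k L] [Fintype τ] (f : B →ₐ[k] L) (hf : Function.Injective f)
    (z : τ → L) (hz : ∀ b, f b ∈ (aeval z : MvPolynomial τ k →ₐ[k] L).range) :
    ∀ s : ℕ, Algebra.trdeg k B = s → s ≤ Fintype.card τ := by
  intro s hs
  let h : B →ₐ[k] (aeval z : MvPolynomial τ k →ₐ[k] L).range := f.codRestrict _ hz
  have h1 := lift_trdeg_le_of_injective h fun a b hab => hf (congrArg Subtype.val hab)
  have h2 := lift_trdeg_le_of_surjective
    (aeval z : MvPolynomial τ k →ₐ[k] L).rangeRestrict (AlgHom.rangeRestrict_surjective _)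
  have h2' : Algebra.trdeg k (aeval z : MvPolynomial τ k →ₐ[k] L).range ≤ (Fintype.card τ : ℕ) := by
    rw [MvPolynomial.trdeg_of_isDomain] at h2
    simpa using h2
  rw [hs] at h1
  have h3 := h1.trans (Cardinal.lift_le.2 h2')
  simpa using h3

theorem le_trdeg_of_isAlgebraic {k B P : Type*} {r : ℕ} [Field k] [CommRing B] [CommRing P]
    [IsDomain P] [Algebra k B] [Algebra k P] (f : B →ₐ[k] P) (h : Algebra.IsAlgebraic f.range P)
    (s : ℕ) (hs : Algebra.trdeg k B = s) (hP : Algebra.trdeg k P = r) : r ≤ s := by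
  have h1 := lift_trdeg_le_of_surjective f.rangeRestrict f.rangeRestrict_surjective
  have h2 := trdeg_add_eq k f.range (A := P)
  rw [trdeg_eq_zero (R := f.range) (A := P), add_zero, hP] at h2
  rw [h2, hs] at h1
  simpa using h1

open Matrix in
-- Cramer's rule: `det M * y = adj M * v`, so `y` is a quotient of elements coming from `D`.
theorem isAlgebraic_of_mulVec_eq {D P : Type*} {r : ℕ} [CommRing D] [IsDomain D] [CommRing P]
    [IsDomain P] [Algebra D P] (M : Matrix (Fin r) (Fin r) D) (v : Fin r → D) (y : Fin r → P)
    (h : M.map (algebraMap D P) *ᵥ y = algebraMap D P ∘ v) (hdet : algebraMap D P M.det ≠ 0)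
    (a : Fin r) : IsAlgebraic D (y a) := by
  refine IsAlgebraic.of_mul (y := algebraMap D P M.det) (mem_nonZeroDivisors_of_ne_zero hdet)
    (isAlgebraic_algebraMap _) ?_
  have h1 := congrArg ((M.map (algebraMap D P)).adjugate *ᵥ ·) h
  simp only [mulVec_mulVec, adjugate_mul, smul_mulVec, one_mulVec] at h1
  have h2 : (M.map (algebraMap D P)).det = algebraMap D P M.det :=
    ((algebraMap D P).map_det M).symm
  have h3 : (M.map (algebraMap D P)).adjugate = M.adjugate.map (algebraMap D P) :=
    ((algebraMap D P).map_adjugate M).symm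
  have h4 := congrFun h1 a
  rw [h2, Pi.smul_apply, smul_eq_mul] at h4
  rw [h4, h3, ← RingHom.map_mulVec]
  exact isAlgebraic_algebraMap _

open Matrix in
theorem isAlgebraic_of_mulVec_eq_of_mem {P : Type*} {r : ℕ} [CommRing P]
    [IsDomain P] [Algebra k P] (D : Subalgebra k P) (M : Matrix (Fin r) (Fin r) P) (v : Fin r → P)
    (y : Fin r → P) (h : M *ᵥ y = v) (hdet : M.det ≠ 0) (hM : ∀ a b, M a b ∈ D)
    (hv : ∀ a, v a ∈ D) (a : Fin r) : IsAlgebraic D (y a) := by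
  have hMD : (Matrix.of fun a b => (⟨M a b, hM a b⟩ : D)).map (algebraMap D P) = M := rfl
  refine isAlgebraic_of_mulVec_eq (.of fun a b => ⟨M a b, hM a b⟩) (fun a => ⟨v a, hv a⟩) y ?_ ?_ a
  · rw [hMD, h]
    rfl
  · rwa [RingHom.map_det, RingHom.mapMatrix_apply, hMD]

open Matrix in
-- Multiplied by `t`, the system `M y = -v` has coefficients in `D`, so each `y a`, and then every
-- polynomial in `y`, is algebraic over `D`. The variable `t` follows because `w * t` lies in `D`
-- for some nonzero `w`.
theorem isAlgebraic_polynomial_of_linear_system {r : ℕ}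
    (D : Subalgebra k (Polynomial (MvPolynomial (Fin r) k)))
    (M : Matrix (Fin r) (Fin r) (MvPolynomial (Fin r) k)) (v : Fin r → MvPolynomial (Fin r) k)
    (hMX : M *ᵥ X = -v) (hdet0 : M.det ≠ 0)
    (hMB : ∀ a b, Polynomial.C (M a b) * Polynomial.X ∈ D)
    (hvB : ∀ a, Polynomial.C (v a) * Polynomial.X ∈ D)
    (w : MvPolynomial (Fin r) k) (hw : w ≠ 0) (hwD : Polynomial.C w * Polynomial.X ∈ D) :
    Algebra.IsAlgebraic D (Polynomial (MvPolynomial (Fin r) k)) := by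
  have hy : ∀ a, IsAlgebraic D (Polynomial.C (X a : MvPolynomial (Fin r) k)) := by
    refine isAlgebraic_of_mulVec_eq_of_mem D
      ((Polynomial.X : Polynomial (MvPolynomial (Fin r) k)) • M.map Polynomial.C)
      ((Polynomial.X : Polynomial (MvPolynomial (Fin r) k)) • -(Polynomial.C ∘ v))
      (Polynomial.C ∘ X) ?_ ?_ ?_ ?_
    · rw [smul_mulVec]
      congr 1
      ext1 a
      rw [← RingHom.map_mulVec, hMX, Pi.neg_apply, map_neg]
      rfl
    · rw [det_smul]
      refine mul_ne_zero (pow_ne_zero _ Polynomial.X_ne_zero) ?_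
      rw [← RingHom.mapMatrix_apply, ← RingHom.map_det]
      exact Polynomial.C_ne_zero.2 hdet0
    · intro a b
      rw [Matrix.smul_apply, smul_eq_mul, mul_comm]
      exact hMB a b
    · intro a
      have h : ((Polynomial.X : Polynomial (MvPolynomial (Fin r) k)) • -(Polynomial.C ∘ v)) a =
          -(Polynomial.C (v a) * Polynomial.X) := by
        rw [Pi.smul_apply, Pi.neg_apply, smul_eq_mul, Function.comp_apply]
        ring
      rw [h]
      exact neg_mem (hvB a)
  have hyC : ∀ w : MvPolynomial (Fin r) k, IsAlgebraic D (Polynomial.C w) := by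
    intro w
    induction w using MvPolynomial.induction_on with
    | C a => exact isAlgebraic_algebraMap (algebraMap k D a)
    | add x y hx hy => rw [map_add]; exact hx.add hy
    | mul_X x a hx => rw [map_mul]; exact hx.mul (hy a)
  have hT : IsAlgebraic D (Polynomial.X : Polynomial (MvPolynomial (Fin r) k)) :=
    IsAlgebraic.of_mul (y := Polynomial.C w)
      (mem_nonZeroDivisors_of_ne_zero (Polynomial.C_ne_zero.2 hw))
      (hyC _) (isAlgebraic_algebraMap (⟨_, hwD⟩ : D))
  refine ⟨fun q => ?_⟩
  induction q using Polynomial.induction_on' with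
  | add p q hp hq => exact hp.add hq
  | monomial j a =>
    rw [← Polynomial.C_mul_X_pow_eq_monomial]
    exact (hyC a).mul (hT.pow j)

theorem le_trdeg_range {k Q P ι : Type*} {r : ℕ} [Field k] [CommRing Q] [CommRing P] [IsDomain P]
    [Algebra k Q] [Algebra k P] (ρ : Q →ₐ[k] P) (b : ι → Q)
    (h : Algebra.IsAlgebraic (aeval (fun i => ρ (b i)) : MvPolynomial ι k →ₐ[k] P).range P) (s : ℕ)
    (hs : Algebra.trdeg k (aeval b : MvPolynomial ι k →ₐ[k] Q).range = s)
    (hP : Algebra.trdeg k P = r) : r ≤ s := by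
  refine le_trdeg_of_isAlgebraic (ρ.comp (aeval b : MvPolynomial ι k →ₐ[k] Q).range.val) ?_ s hs hP
  have h1 : (ρ.comp (aeval b : MvPolynomial ι k →ₐ[k] Q).range.val).range =
      (aeval (fun i => ρ (b i)) : MvPolynomial ι k →ₐ[k] P).range := by
    rw [AlgHom.range_comp, Subalgebra.range_val, ← AlgHom.range_comp, comp_aeval]
  rw [h1]
  exact h

theorem trdeg_polynomial_mvPolynomial (k : Type*) [Field k] (r : ℕ) :
    Algebra.trdeg k (Polynomial (MvPolynomial (Fin r) k)) = r + 1 := by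
  have h := lift_trdeg_add_eq k (MvPolynomial (Fin r) k) (Polynomial (MvPolynomial (Fin r) k))
  rw [MvPolynomial.trdeg_of_isDomain, Polynomial.trdeg_of_isDomain] at h
  simpa using h.symm

open Matrix in
/-- Restricting the forms `g i` to the affine space `p₀ + E y`. -/
theorem le_trdeg_of_linear_relations [Fintype σ] {m r : ℕ} (g : Fin m → MvPolynomial σ k)
    (Ψ : Matrix κ σ (MvPolynomial σ k))
    (hΨg : ∀ j l, Ψ j l ∈ Submodule.span k (Set.range g))
    (hΨX : ∀ j, ∑ l, Ψ j l * X l = 0)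
    (p₀ : σ → k) (i₀ : Fin m) (hp₀ : eval p₀ (g i₀) ≠ 0)
    (R : Fin r → κ) (E : Matrix σ (Fin r) k)
    (hE : (Ψ.submatrix R id).map (eval p₀) * E = (1 : Matrix (Fin r) (Fin r) k)) (s : ℕ)
    (hs : Algebra.trdeg k (aeval (fun i => Polynomial.C (g i) * Polynomial.X) :
      MvPolynomial (Fin m) k →ₐ[k] Polynomial (MvPolynomial σ k)).range = s) :
    r + 1 ≤ s := by
  classical
  -- `Y` parametrizes the slice; its origin `y = 0` is the point `p₀`.
  let Y : σ → MvPolynomial (Fin r) k := fun l => C (p₀ l) + ∑ a, C (E l a) * X a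
  let ρ : MvPolynomial σ k →ₐ[k] MvPolynomial (Fin r) k := aeval Y
  have hρ0 : ∀ f, eval 0 (ρ f) = eval p₀ f := fun f => by
    change (eval 0) (aeval Y f) = _
    rw [← coe_aeval_eq_eval, RingHom.coe_coe, ← AlgHom.comp_apply, comp_aeval, ← coe_aeval_eq_eval]
    simp [Y]
  let ρt : Polynomial (MvPolynomial σ k) →ₐ[k] Polynomial (MvPolynomial (Fin r) k) :=
    Polynomial.mapAlgHom ρ
  refine le_trdeg_range ρt (fun i => Polynomial.C (g i) * Polynomial.X) ?_ s hs
    (by exact_mod_cast trdeg_polynomial_mvPolynomial k r)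
  have hb : (fun i => ρt (Polynomial.C (g i) * Polynomial.X)) =
      fun i => Polynomial.C (ρ (g i)) * Polynomial.X := by
    ext1 i
    simp [ρt]
  rw [hb]
  clear hs hb
  generalize hD : (aeval (fun i => Polynomial.C (ρ (g i)) * Polynomial.X) :
      MvPolynomial (Fin m) k →ₐ[k] Polynomial (MvPolynomial (Fin r) k)).range = D
  have hgen : ∀ w ∈ Submodule.span k (Set.range g), Polynomial.C (ρ w) * Polynomial.X ∈ D := by
    intro w hw
    induction hw using Submodule.span_induction with
    | mem w hw =>
      obtain ⟨i, rfl⟩ := hw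
      rw [← hD]
      exact ⟨X i, by simp⟩
    | zero => simp
    | add x y _ _ hx hy => rw [map_add, map_add, add_mul]; exact add_mem hx hy
    | smul a x _ hx =>
      have := D.smul_mem hx a
      rw [map_smul]
      convert this using 1
      simp [Algebra.smul_def, Polynomial.algebraMap_apply, mul_assoc]
  -- the relations restricted
  let M : Matrix (Fin r) (Fin r) (MvPolynomial (Fin r) k) :=
    ((Ψ.submatrix R id).map ρ) * (E.map C : Matrix σ (Fin r) (MvPolynomial (Fin r) k))
  let v : Fin r → MvPolynomial (Fin r) k := ((Ψ.submatrix R id).map ρ) *ᵥ (fun l => C (p₀ l))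
  -- Restricting `Ψ X = 0` to the slice gives `Ψ (p₀ + E y) = 0`, where `Ψ p₀` is `v` and `Ψ E` is
  -- `M`; both still depend on `y`.
  have hMX : M *ᵥ X = -v := by
    have h1 : ((Ψ.submatrix R id).map ρ) *ᵥ Y = 0 := by
      ext1 a
      have := congrArg ρ (hΨX (R a))
      simpa [mulVec, dotProduct, ρ] using this
    have hY : Y = (fun l => C (p₀ l)) + E.map C *ᵥ X := by
      ext1 l
      simp [Y, mulVec, dotProduct]
    rw [hY, mulVec_add, mulVec_mulVec] at h1
    exact eq_neg_of_add_eq_zero_right h1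
  have hMab : ∀ a b, M a b = ∑ l, ρ (Ψ (R a) l) * C (E l b) := fun _ _ => rfl
  have hdet0 : M.det ≠ 0 := by
    intro h
    have h1 := congrArg (eval 0) h
    rw [RingHom.map_det, map_zero] at h1
    have h2 : (eval (0 : Fin r → k)).mapMatrix M = 1 := by
      rw [← hE]
      ext a b
      simp only [RingHom.mapMatrix_apply, Matrix.map_apply, hMab, map_sum, map_mul, hρ0, eval_C,
        Matrix.mul_apply, Matrix.submatrix_apply, id]
    rw [h2, det_one] at h1
    exact one_ne_zero h1
  -- entries of `M` and `v`, times the variable, are in the subalgebra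
  have hMB : ∀ a b, Polynomial.C (M a b) * Polynomial.X ∈ D := by
    intro a b
    have : M a b = ρ (∑ l, E l b • Ψ (R a) l) := by
      simp only [hMab, map_sum, map_smul]
      simp [smul_eq_C_mul, mul_comm]
    rw [this]
    exact hgen _ (Submodule.sum_mem _ fun l _ => Submodule.smul_mem _ _ (hΨg _ _))
  have hvB : ∀ a, Polynomial.C (v a) * Polynomial.X ∈ D := by
    intro a
    have : v a = ρ (∑ l, p₀ l • Ψ (R a) l) := by
      simp [v, mulVec, dotProduct, map_sum, smul_eq_C_mul, mul_comm, ρ, algebraMap_eq]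
    rw [this]
    exact hgen _ (Submodule.sum_mem _ fun l _ => Submodule.smul_mem _ _ (hΨg _ _))
  refine isAlgebraic_polynomial_of_linear_system D M v hMX hdet0 hMB hvB (ρ (g i₀)) ?_
    (hgen _ (Submodule.subset_span ⟨i₀, rfl⟩))
  intro h
  apply hp₀
  rw [← hρ0, h, map_zero]

/-- The point `u / Δ` of the slice has the same image under the forms as the generic point. Hence
all `g i * t` are polynomials in the `r` slice coordinates of that point and one scaling factor. -/
theorem trdeg_le_of_section {L : Type*} [Field L] [Algebra k L]
    (φ : Polynomial (MvPolynomial σ k) →ₐ[k] L) (hφ : Function.Injective φ)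
    {m r δ : ℕ} (g : Fin m → MvPolynomial σ k)
    (hg : ∀ i, (g i).IsHomogeneous δ) (p₀ : σ → k) (i₀ : Fin m) (E : Matrix σ (Fin r) k)
    (Δ : MvPolynomial σ k) (hΔ : Δ ≠ 0) (t : Fin r → MvPolynomial σ k) (u : σ → MvPolynomial σ k)
    (hu : ∀ l, u l = Δ * C (p₀ l) + ∑ a, C (E l a) * t a)
    (hu0 : aeval u (g i₀) ≠ 0)
    (hug : ∀ i j, aeval u (g i) * g j = aeval u (g j) * g i) (s : ℕ)
    (hs : Algebra.trdeg k (aeval (fun i => Polynomial.C (g i) * Polynomial.X) :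
      MvPolynomial (Fin m) k →ₐ[k] Polynomial (MvPolynomial σ k)).range = s) :
    s ≤ r + 1 := by
  let c : MvPolynomial σ k →ₐ[k] L := φ.comp Polynomial.CAlgHom
  have hc : Function.Injective c := hφ.comp Polynomial.C_injective
  -- The extra coordinate `z none` is chosen so that `g i₀ (u / Δ) * z none = g i₀ * t`; the power
  -- `δ` of `Δ` comes from homogeneity.
  let z : Option (Fin r) → L := fun o => o.elim
    (φ (Polynomial.C (g i₀) * Polynomial.X) * c Δ ^ δ / c (aeval u (g i₀)))
    (fun a => c (t a) / c Δ)
  have hcΔ : c Δ ≠ 0 := (map_ne_zero_iff c hc).2 hΔ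
  have hcu : c (aeval u (g i₀)) ≠ 0 := (map_ne_zero_iff c hc).2 hu0
  let u' : σ → L := fun l => algebraMap k L (p₀ l) + ∑ a, algebraMap k L (E l a) * z (some a)
  have huu' : (fun l => c (u l)) = c Δ • u' := by
    ext1 l
    have hC : ∀ a : k, c (C a) = algebraMap k L a := fun a => c.commutes a
    simp only [hu, map_add, map_mul, map_sum, hC, Pi.smul_apply, smul_eq_mul, u', mul_add,
      Finset.mul_sum, z, Option.elim_some]
    congr 1
    refine Finset.sum_congr rfl fun a _ => ?_
    field_simp
  have hgu : ∀ i, c (aeval u (g i)) = c Δ ^ δ * aeval u' (g i) := by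
    intro i
    rw [← eval_smul_of_isHomogeneous (hg i), ← huu', ← AlgHom.comp_apply, comp_aeval]
  have hu'mem : ∀ l, u' l ∈ (aeval z : MvPolynomial (Option (Fin r)) k →ₐ[k] L).range := by
    intro l
    refine add_mem (Subalgebra.algebraMap_mem _ _) (sum_mem fun a _ =>
      mul_mem (Subalgebra.algebraMap_mem _ _) ⟨X (some a), by simp⟩)
  have hgen : ∀ i, φ (Polynomial.C (g i) * Polynomial.X) ∈
      (aeval z : MvPolynomial (Option (Fin r)) k →ₐ[k] L).range := by
    intro i
    have h1 : φ (Polynomial.C (g i) * Polynomial.X) = aeval u' (g i) * z none := by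
      have h2 : c (aeval u (g i)) * c (g i₀) = c (aeval u (g i₀)) * c (g i) := by
        rw [← map_mul, ← map_mul, hug]
      have h3 : ∀ f, φ (Polynomial.C f * Polynomial.X) = c f * φ Polynomial.X := fun f =>
        map_mul _ _ _
      simp only [z, Option.elim_none]
      rw [eq_comm, mul_div_assoc', div_eq_iff hcu, h3, h3]
      have h4 := hgu i
      linear_combination (φ Polynomial.X) * h2 - (φ Polynomial.X * c (g i₀)) * h4
    rw [h1]
    refine mul_mem ?_ ⟨X none, by simp⟩
    rw [aeval_def, eval₂_eq]
    refine sum_mem fun d _ => mul_mem (Subalgebra.algebraMap_mem _ _)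
      (prod_mem fun l _ => pow_mem (hu'mem l) _)
  have h := trdeg_le_of_range_subset (φ.comp (aeval (fun i => Polynomial.C (g i) * Polynomial.X) :
      MvPolynomial (Fin m) k →ₐ[k] Polynomial (MvPolynomial σ k)).range.val)
      (hφ.comp Subtype.val_injective) z ?_ s hs
  · simpa using h
  · rintro ⟨_, q, rfl⟩
    change φ (aeval _ q) ∈ _
    rw [← AlgHom.comp_apply, comp_aeval, aeval_def, eval₂_eq]
    refine sum_mem fun d _ => mul_mem (Subalgebra.algebraMap_mem _ _)
      (prod_mem fun l _ => pow_mem (hgen l) _)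

open Matrix in
-- The kernel of the chosen rows of `Ψ` at a general point is a linear space contained in the fibre
-- through that point, in the sense of `hfib`. Intersecting it with the slice supplies the section
-- `u`, with denominators cleared.
theorem trdeg_le_of_linear_relations [Fintype σ] [Infinite k] {m r δ : ℕ}
    (g : Fin m → MvPolynomial σ k)
    (hg : ∀ i, (g i).IsHomogeneous δ)
    (Ψ : Matrix κ σ (MvPolynomial σ k))
    (hΨX : ∀ j, ∑ l, Ψ j l * X l = 0)
    (p₀ : σ → k) (i₀ : Fin m) (hp₀ : eval p₀ (g i₀) ≠ 0)
    (R : Fin r → κ) (E : Matrix σ (Fin r) k)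
    (hE : (Ψ.submatrix R id).map (eval p₀) * E = (1 : Matrix (Fin r) (Fin r) k))
    (hfib : ∀ p, eval p (g i₀) ≠ 0 →
      eval p (Ψ.submatrix R id *
        (E.map C : Matrix σ (Fin r) (MvPolynomial σ k)) :
          Matrix (Fin r) (Fin r) (MvPolynomial σ k)).det ≠ 0 →
      ∀ y, (Ψ.submatrix R id).map (eval p) *ᵥ y = 0 →
        ∀ i j, eval y (g i) * eval p (g j) = eval y (g j) * eval p (g i))
    (s : ℕ)
    (hs : Algebra.trdeg k (aeval (fun i => Polynomial.C (g i) * Polynomial.X) :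
      MvPolynomial (Fin m) k →ₐ[k] Polynomial (MvPolynomial σ k)).range = s) :
    s ≤ r + 1 := by
  let Ψ' := Ψ.submatrix R id
  let M : Matrix (Fin r) (Fin r) (MvPolynomial σ k) :=
    Ψ' * (E.map C : Matrix σ (Fin r) (MvPolynomial σ k))
  let v : Fin r → MvPolynomial σ k := Ψ' *ᵥ (fun l => C (p₀ l))
  -- Cramer's solution of `M t = -det M • v`, the condition that `u` be killed by the chosen rows.
  let t : Fin r → MvPolynomial σ k := -(M.adjugate *ᵥ v)
  let u : σ → MvPolynomial σ k := fun l => M.det * C (p₀ l) + ∑ a, C (E l a) * t a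
  have hu : u = M.det • (fun l => C (p₀ l)) + E.map C *ᵥ t := by
    ext1 l
    simp [u, mulVec, dotProduct]
  have hΨu : Ψ' *ᵥ u = 0 := by
    rw [hu, mulVec_add, mulVec_smul, mulVec_mulVec]
    change M.det • v + M *ᵥ -(M.adjugate *ᵥ v) = 0
    rw [mulVec_neg, mulVec_mulVec, mul_adjugate, smul_mulVec, one_mulVec, add_neg_cancel]
  have hM0 : M.map (eval p₀) = 1 := by
    rw [← hE]
    simp only [M]
    rw [Matrix.map_mul]
    congr 1
    ext a b
    simp
  have hdet0 : eval p₀ M.det = 1 := by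
    rw [RingHom.map_det, RingHom.mapMatrix_apply, hM0, det_one]
  have hv0 : ∀ a, eval p₀ (v a) = 0 := by
    intro a
    have h := congrArg (eval p₀) (hΨX (R a))
    simpa [v, Ψ', mulVec, dotProduct] using h
  have ht0 : ∀ a, eval p₀ (t a) = 0 := by
    intro a
    simp [t, mulVec, dotProduct, hv0]
  have hu0 : ∀ l, eval p₀ (u l) = p₀ l := by
    intro l
    simp [u, ht0, hdet0]
  have hevalu : ∀ p f, eval p (aeval u f) = eval (fun l => eval p (u l)) f := by
    intro p f
    rw [← coe_aeval_eq_eval, RingHom.coe_coe, ← AlgHom.comp_apply, comp_aeval,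
      ← coe_aeval_eq_eval]
    rfl
  have hgu0 : aeval u (g i₀) ≠ 0 := by
    intro h
    apply hp₀
    have h1 := congrArg (eval p₀) h
    rwa [hevalu, funext hu0, map_zero] at h1
  have hΔ : M.det ≠ 0 := by
    intro h
    rw [h, map_zero] at hdet0
    exact zero_ne_one hdet0
  refine trdeg_le_of_section
    (IsScalarTower.toAlgHom k _ (FractionRing (Polynomial (MvPolynomial σ k))))
    (IsFractionRing.injective (Polynomial (MvPolynomial σ k)) _) g hg p₀ i₀ E M.det hΔ t u
    (fun _ => rfl) hgu0 ?_ s hs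
  intro i j
  have hgi : g i₀ ≠ 0 := fun h => hp₀ (by rw [h, map_zero])
  rw [← sub_eq_zero]
  -- The factor `g i₀ * det M` makes the identity trivial at the points where `hfib` says nothing,
  -- so it can be checked at every point over the infinite field.
  refine (mul_eq_zero.1 (?_ : (g i₀ * M.det) * _ = 0)).resolve_left (mul_ne_zero hgi hΔ)
  refine MvPolynomial.funext fun p => ?_
  rw [map_mul, map_mul, map_zero, map_sub, map_mul, map_mul, hevalu, hevalu]
  by_cases h1 : eval p (g i₀) = 0
  · simp [h1]
  by_cases h2 : eval p M.det = 0
  · simp [h2]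
  rw [hfib p h1 h2 (fun l => eval p (u l)) ?_ i j, sub_self, mul_zero]
  ext1 a
  have h := congrArg (eval p) (congrFun hΨu a)
  rw [RingHom.map_mulVec] at h
  rw [Pi.zero_apply, map_zero] at h
  exact h

end Trdeg

/-! ### Generic rank and the choice of the slice. -/

open Matrix in
theorem exists_submatrix_mul_eq_one {k κ σ : Type*} [Field k] [Fintype σ] [Finite κ]
    (Ψ : Matrix κ σ k) : ∃ (R : Fin Ψ.rank → κ) (E : Matrix σ (Fin Ψ.rank) k),
      Ψ.submatrix R id * E = (1 : Matrix (Fin Ψ.rank) (Fin Ψ.rank) k) := by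
  classical
  obtain ⟨f, hf, hspan, hind⟩ := Submodule.exists_fun_fin_finrank_span_eq k (Set.range Ψ.row)
  choose R hR using hf
  have hf : (Ψ.submatrix R id).row = f := funext hR
  have hli : LinearIndependent k (Ψ.submatrix R id).row := hf ▸ hind
  rw [rank_eq_finrank_span_row]
  refine ⟨R, ?_⟩
  rw [← mulVec_surjective_iff_exists_right_inverse, ← coe_mulVecLin, ← LinearMap.range_eq_top]
  apply Submodule.eq_top_of_finrank_eq
  have h := hli.rank_matrix
  rw [Matrix.rank] at h
  rw [h, Module.finrank_fintype_fun_eq_card]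

open Matrix in
-- The slice is taken at a point `p₀` of maximal rank. A minor that is nonzero there stays nonzero
-- on an open set, where the rank must therefore equal `r`.
theorem exists_generic_rank {k κ σ : Type*} [Field k] [Infinite k] [Fintype σ] [Finite κ]
    {m δ : ℕ} (g : Fin m → MvPolynomial σ k)
    (hg : ∀ i, (g i).IsHomogeneous δ)
    (Ψ : Matrix κ σ (MvPolynomial σ k))
    (hΨg : ∀ j l, Ψ j l ∈ Submodule.span k (Set.range g))
    (hΨX : ∀ j, ∑ l, Ψ j l * X l = 0)
    (hfib : ∀ p y, (∃ i, eval p (g i) ≠ 0) → Ψ.map (eval p) *ᵥ y = 0 →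
        ∀ i j, eval y (g i) * eval p (g j) = eval y (g j) * eval p (g i))
    (hne : ∃ p i, eval p (g i) ≠ 0) :
    ∃ (r : ℕ) (f : MvPolynomial σ k), f ≠ 0 ∧
      (∀ p, eval p f ≠ 0 → (∃ i, eval p (g i) ≠ 0) ∧ (Ψ.map (eval p)).rank = r) ∧
      ∀ s : ℕ, Algebra.trdeg k (aeval (fun i => Polynomial.C (g i) * Polynomial.X) :
        MvPolynomial (Fin m) k →ₐ[k] Polynomial (MvPolynomial σ k)).range = s → s = r + 1 := by
  classical
  let G : Set (σ → k) := {p | ∃ i, eval p (g i) ≠ 0}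
  obtain ⟨p₀, ⟨i₀, hp₀⟩, hr⟩ := Nat.sSup_mem (s := (fun p => (Ψ.map (eval p)).rank) '' G)
    (Set.Nonempty.image _ hne) ⟨Fintype.card σ, by
      rintro _ ⟨p, -, rfl⟩
      exact rank_le_card_width _⟩
  have hmax : ∀ p ∈ G, (Ψ.map (eval p)).rank ≤ (Ψ.map (eval p₀)).rank := by
    intro p hp
    change _ ≤ (fun p => (Ψ.map (eval p)).rank) p₀
    rw [hr]
    refine le_csSup ⟨Fintype.card σ, ?_⟩ ⟨p, hp, rfl⟩
    rintro _ ⟨p, -, rfl⟩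
    exact rank_le_card_width _
  obtain ⟨R, E, hE⟩ := exists_submatrix_mul_eq_one (Ψ.map (eval p₀))
  generalize (Ψ.map (eval p₀)).rank = r at *
  clear hr
  let M : Matrix (Fin r) (Fin r) (MvPolynomial σ k) :=
    Ψ.submatrix R id * (E.map C : Matrix σ (Fin r) (MvPolynomial σ k))
  have hMp : ∀ p, M.map (eval p) = (Ψ.map (eval p)).submatrix R id * E := by
    intro p
    simp only [M]
    rw [Matrix.map_mul]
    congr 1
    ext a b
    simp
  have hrk : ∀ p, eval p (g i₀) ≠ 0 → eval p M.det ≠ 0 →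
      ((Ψ.map (eval p)).submatrix R id).rank = r ∧ (Ψ.map (eval p)).rank = r := by
    intro p hp hM
    have h1 : (M.map (eval p)).rank = r := by
      rw [rank_of_isUnit, Fintype.card_fin]
      rw [isUnit_iff_isUnit_det, isUnit_iff_ne_zero, ← RingHom.mapMatrix_apply, ← RingHom.map_det]
      exact hM
    have h2 : r ≤ ((Ψ.map (eval p)).submatrix R id).rank := by
      refine h1.symm.le.trans ?_
      rw [hMp]
      exact rank_mul_le_left _ _
    have h3 := rank_submatrix_le (Ψ.map (eval p)) R id
    have h4 := hmax p ⟨i₀, hp⟩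
    omega
  have hker : ∀ p, eval p (g i₀) ≠ 0 → eval p M.det ≠ 0 → ∀ y,
      (Ψ.submatrix R id).map (eval p) *ᵥ y = 0 → Ψ.map (eval p) *ᵥ y = 0 := by
    intro p hp hM y hy
    obtain ⟨h1, h2⟩ := hrk p hp hM
    -- Both matrices have rank `r`, so the inclusion of kernels is an equality by dimension.
    have hle : LinearMap.ker (Ψ.map (eval p)).mulVecLin ≤
        LinearMap.ker ((Ψ.map (eval p)).submatrix R id).mulVecLin := by
      intro z hz
      ext1 a
      exact congrFun (LinearMap.mem_ker.1 hz) (R a)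
    have h3 := (Ψ.map (eval p)).mulVecLin.finrank_range_add_finrank_ker
    have h4 := ((Ψ.map (eval p)).submatrix R id).mulVecLin.finrank_range_add_finrank_ker
    have heq := Submodule.eq_of_le_of_finrank_eq hle (by
      unfold Matrix.rank at h1 h2
      omega)
    have : y ∈ LinearMap.ker ((Ψ.map (eval p)).submatrix R id).mulVecLin := hy
    rw [← heq] at this
    exact this
  refine ⟨r, g i₀ * M.det, mul_ne_zero ?_ ?_, ?_, ?_⟩
  · rintro h
    exact hp₀ (by rw [h, map_zero])
  · intro h
    have h1 : eval p₀ M.det = 1 := by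
      rw [RingHom.map_det, RingHom.mapMatrix_apply, hMp, hE, det_one]
    rw [h, map_zero] at h1
    exact zero_ne_one h1
  · intro p hp
    rw [map_mul] at hp
    exact ⟨⟨i₀, left_ne_zero_of_mul hp⟩,
      (hrk p (left_ne_zero_of_mul hp) (right_ne_zero_of_mul hp)).2⟩
  · intro s hs
    apply le_antisymm
    · refine trdeg_le_of_linear_relations g hg Ψ hΨX p₀ i₀ hp₀ R E hE ?_ s hs
      intro p h1 h2 y hy
      exact hfib p y ⟨i₀, h1⟩ (hker p h1 h2 y hy)
    · exact le_trdeg_of_linear_relations g Ψ hΨg hΨX p₀ i₀ hp₀ R E hE s hs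

/-! ### The special fibre ring as the algebra `k[g i * t]`. -/

section Fiber
variable {k : Type*} [Field k] {σ : Type*}

attribute [local instance] MvPolynomial.gradedAlgebra

/-- Elements of an ideal generated in degree `a` have no components in lower degrees, and the
component in degree `a` is a `k`-combination of the generators. -/
theorem homogeneousComponent_of_mem_span {T : Set (MvPolynomial σ k)} {a : ℕ}
    (hT : ∀ f ∈ T, f.IsHomogeneous a) {f : MvPolynomial σ k} (hf : f ∈ Ideal.span T) :
    (∀ e < a, homogeneousComponent e f = 0) ∧
      homogeneousComponent a f ∈ Submodule.span k T := by
  induction hf using Submodule.span_induction with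
  | mem f hf =>
    refine ⟨fun e he => ?_, ?_⟩
    · rw [homogeneousComponent_of_mem (hT f hf), if_neg he.ne]
    · rw [homogeneousComponent_of_mem (hT f hf), if_pos rfl]
      exact Submodule.subset_span hf
  | zero => simp
  | add x y _ _ hx hy =>
    refine ⟨fun e he => ?_, ?_⟩
    · rw [map_add, hx.1 e he, hy.1 e he, add_zero]
    · rw [map_add]
      exact add_mem hx.2 hy.2
  | smul s x _ hx =>
    classical
    have key : ∀ e ≤ a, homogeneousComponent e (s * x) =
        C (coeff 0 s) * homogeneousComponent e x := by
      intro e he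
      conv_lhs => rw [← sum_homogeneousComponent x, Finset.mul_sum, map_sum]
      have h0 : ∀ i, homogeneousComponent e (s * homogeneousComponent i x) =
          if i = e then C (coeff 0 s) * homogeneousComponent e x else 0 := by
        intro i
        split_ifs with h
        · subst h
          exact homogeneousComponent_mul_self _ (homogeneousComponent_isHomogeneous _ _)
        · rw [homogeneousComponent_mul_of_isHomogeneous _ (homogeneousComponent_isHomogeneous _ _)]
          split_ifs with h'
          · rw [hx.1 i (by omega), mul_zero]
          · rfl
      simp only [h0, Finset.sum_ite_eq', Finset.mem_range]
      split_ifs with h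
      · rfl
      · rw [homogeneousComponent_eq_zero _ _ (by omega), mul_zero]
    refine ⟨fun e he => ?_, ?_⟩
    · rw [smul_eq_mul, key e he.le, hx.1 e he, mul_zero]
    · rw [smul_eq_mul, key a le_rfl, ← smul_eq_C_mul]
      exact Submodule.smul_mem _ _ hx.2

theorem homogeneousComponent_eq_zero_of_mem_mul {I J : Ideal (MvPolynomial σ k)} {a b : ℕ}
    (hI : ∀ f ∈ I, ∀ e < a, homogeneousComponent e f = 0)
    (hJ : ∀ f ∈ J, ∀ e < b, homogeneousComponent e f = 0) {f : MvPolynomial σ k}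
    (hf : f ∈ I * J) : ∀ e < a + b, homogeneousComponent e f = 0 := by
  classical
  induction hf using Submodule.mul_induction_on' with
  | mem_mul_mem x hx y hy =>
    intro e he
    rw [← sum_homogeneousComponent y, Finset.mul_sum, map_sum]
    refine Finset.sum_eq_zero fun i _ => ?_
    rw [homogeneousComponent_mul_of_isHomogeneous _ (homogeneousComponent_isHomogeneous _ _)]
    split_ifs with h
    · rcases lt_or_ge i b with h1 | h1
      · rw [hJ y hy i h1, mul_zero]
      · rw [hI x hx _ (by omega), zero_mul]
    · rfl
  | add x _ y _ hx hy =>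
    intro e he
    rw [map_add, hx e he, hy e he, add_zero]

theorem homogeneousComponent_eq_zero_of_mem_pow {I : Ideal (MvPolynomial σ k)} {a : ℕ}
    (hI : ∀ f ∈ I, ∀ e < a, homogeneousComponent e f = 0) (d : ℕ) :
    ∀ f ∈ I ^ d, ∀ e < d * a, homogeneousComponent e f = 0 := by
  induction d with
  | zero => intro f _ e he; omega
  | succ d ih =>
    intro f hf e he
    rw [pow_succ] at hf
    exact homogeneousComponent_eq_zero_of_mem_mul ih hI hf e (by rw [← Nat.succ_mul]; exact he)

/-- The Rees algebra is graded by powers of `t`, with `I ^ d` in degree `d`; multiplying by the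
extended ideal puts the factor `m` on each piece. -/
theorem coeff_mem_of_mem_map_reesAlgebra {S : Type*} [CommRing S] (I m : Ideal S)
    (z : reesAlgebra I)
    (hz : z ∈ m.map (algebraMap S (reesAlgebra I))) (d : ℕ) :
    (z : Polynomial S).coeff d ∈ m * I ^ d := by
  induction hz using Submodule.span_induction generalizing d with
  | mem z hz =>
    obtain ⟨x, hx, rfl⟩ := hz
    change (Polynomial.C x).coeff d ∈ _
    rw [Polynomial.coeff_C]
    split_ifs with h
    · subst h
      simpa using hx
    · exact zero_mem _
  | zero => simp
  | add x y _ _ hx hy => exact add_mem (hx d) (hy d)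
  | smul a x _ hx =>
    change ((a : Polynomial S) * (x : Polynomial S)).coeff d ∈ _
    rw [Polynomial.coeff_mul]
    refine Submodule.sum_mem _ fun ij hij => ?_
    rw [← Finset.HasAntidiagonal.mem_antidiagonal.1 hij, pow_add, mul_left_comm]
    exact Ideal.mul_mem_mul (a.2 ij.1) (hx ij.2)

theorem isHomogeneous_coeff_aeval {m δ : ℕ} (g : Fin m → MvPolynomial σ k)
    (hg : ∀ i, (g i).IsHomogeneous δ) (q : MvPolynomial (Fin m) k) (d : ℕ) :
    ((aeval (fun i => Polynomial.C (g i) * Polynomial.X) q :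
      Polynomial (MvPolynomial σ k)).coeff d).IsHomogeneous (d * δ) := by
  induction q using MvPolynomial.induction_on generalizing d with
  | C a =>
    rw [algHom_C, Polynomial.algebraMap_apply, Polynomial.coeff_C]
    split_ifs with h
    · subst h
      simpa using isHomogeneous_C σ a
    · exact isHomogeneous_zero _ _ _
  | add p q hp hq =>
    rw [map_add, Polynomial.coeff_add]
    exact (hp d).add (hq d)
  | mul_X p i hp =>
    rw [map_mul, aeval_X, ← mul_assoc]
    cases d with
    | zero =>
      rw [Polynomial.coeff_mul_X_zero]
      exact isHomogeneous_zero _ _ _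
    | succ d =>
      rw [Polynomial.coeff_mul_X, Polynomial.coeff_mul_C, Nat.succ_mul]
      exact (hp d).mul (hg i)

theorem C_coeff_zero_sub_mem (s : MvPolynomial σ k) :
    C (coeff 0 s) - s ∈ Ideal.span (Set.range (X : σ → MvPolynomial σ k)) := by
  classical
  rw [← Ideal.Quotient.eq]
  induction s using MvPolynomial.induction_on with
  | C a => simp
  | add p q hp hq => rw [coeff_add, map_add, map_add, hp, hq, map_add]
  | mul_X p i hp =>
    have : (Ideal.Quotient.mk (Ideal.span (Set.range (X : σ → MvPolynomial σ k)))) (X i) = 0 :=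
      Ideal.Quotient.eq_zero_iff_mem.2 (Ideal.subset_span ⟨i, rfl⟩)
    rw [map_mul, this, mul_zero, coeff_mul_X']
    simp

/-- The special fiber ring of an ideal generated by forms `g i` of the same degree is the algebra
generated by the `g i * t`. -/
theorem ringKrullDim_fiber {m δ : ℕ} (g : Fin m → MvPolynomial σ k)
    (hg : ∀ i, (g i).IsHomogeneous δ) (I : Ideal (MvPolynomial σ k))
    (hI : Ideal.span (Set.range g) = I) :
    ringKrullDim (reesAlgebra I ⧸ (Ideal.span (Set.range (X : σ → MvPolynomial σ k))).map
      (algebraMap (MvPolynomial σ k) (reesAlgebra I))) =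
    ringKrullDim (aeval (fun i => Polynomial.C (g i) * Polynomial.X) :
        MvPolynomial (Fin m) k →ₐ[k] Polynomial (MvPolynomial σ k)).range := by
  let 𝔪 := Ideal.span (Set.range (X : σ → MvPolynomial σ k))
  let 𝔪R := 𝔪.map (algebraMap (MvPolynomial σ k) (reesAlgebra I))
  have hgI : ∀ i, g i ∈ I := fun i => hI ▸ Ideal.subset_span ⟨i, rfl⟩
  have hmem : ∀ i, Polynomial.C (g i) * Polynomial.X ∈ reesAlgebra I := fun i => by
    rw [Polynomial.C_mul_X_eq_monomial]
    exact reesAlgebra.monomial_mem.2 (by simpa using hgI i)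
  let θ : MvPolynomial (Fin m) k →ₐ[k] reesAlgebra I := aeval fun i => ⟨_, hmem i⟩
  let ψ : MvPolynomial (Fin m) k →ₐ[k] Polynomial (MvPolynomial σ k) :=
    aeval (fun i => Polynomial.C (g i) * Polynomial.X)
  have hθψ : ∀ q, (θ q : Polynomial (MvPolynomial σ k)) = ψ q := by
    intro q
    have h : ((reesAlgebra I).val.restrictScalars k).comp θ = ψ := by
      ext1 i
      simp [θ, ψ]
    exact congrArg (fun φ => φ q) h
  let θ' : MvPolynomial (Fin m) k →+* reesAlgebra I ⧸ 𝔪R := (Ideal.Quotient.mk 𝔪R).comp θ.toRingHom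
  have hsurj : Function.Surjective θ' := by
    have hrange : ∀ f (hf : f ∈ reesAlgebra I),
        Ideal.Quotient.mk 𝔪R ⟨f, hf⟩ ∈ θ'.range := by
      have hC : ∀ s : MvPolynomial σ k,
          Ideal.Quotient.mk 𝔪R (algebraMap (MvPolynomial σ k) (reesAlgebra I) s) ∈
          θ'.range := by
        intro s
        -- Modulo the homogeneous maximal ideal a polynomial equals its constant term.
        refine ⟨C (coeff 0 s), ?_⟩
        have h1 : θ' (C (coeff 0 s)) =
            Ideal.Quotient.mk 𝔪R
              (algebraMap (MvPolynomial σ k) (reesAlgebra I) (C (coeff 0 s))) := by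
          change Ideal.Quotient.mk 𝔪R (θ (algebraMap k _ _)) = _
          rw [θ.commutes]
          rfl
        rw [h1, Ideal.Quotient.eq, ← map_sub]
        refine Ideal.mem_map_of_mem _ ?_
        exact C_coeff_zero_sub_mem s
      have hadj : ∀ f (hf : f ∈ Algebra.adjoin (MvPolynomial σ k)
          (Submodule.map (Polynomial.monomial 1 : MvPolynomial σ k →ₗ[MvPolynomial σ k] _) I :
            Set (Polynomial (MvPolynomial σ k)))), ∃ hf : f ∈ reesAlgebra I,
          Ideal.Quotient.mk 𝔪R ⟨f, hf⟩ ∈ θ'.range := by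
        intro f hf
        induction hf using Algebra.adjoin_induction with
        | mem f hf =>
          obtain ⟨x, hx, rfl⟩ := hf
          have hx' : x ∈ Ideal.span (Set.range g) := hI ▸ hx
          clear hx
          induction hx' using Submodule.span_induction with
          | mem x hx =>
            obtain ⟨i, rfl⟩ := hx
            refine ⟨reesAlgebra.monomial_mem.2 (by simpa using hgI i), X i, ?_⟩
            change Ideal.Quotient.mk 𝔪R (θ (X i)) = _
            congr 1
            apply Subtype.ext
            simp [θ, Polynomial.C_mul_X_eq_monomial]
          | zero =>
            simp only [map_zero]
            exact ⟨zero_mem _, 0, map_zero _⟩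
          | add x y _ _ hx hy =>
            obtain ⟨h1, h1'⟩ := hx
            obtain ⟨h2, h2'⟩ := hy
            simp only [map_add]
            exact ⟨add_mem h1 h2, add_mem h1' h2'⟩
          | smul a x _ hx =>
            obtain ⟨h1, h1'⟩ := hx
            simp only [map_smul]
            refine ⟨Subalgebra.smul_mem _ h1 a, ?_⟩
            have := mul_mem (hC a) h1'
            rw [← map_mul, ← Algebra.smul_def] at this
            exact this
        | algebraMap a => exact ⟨Subalgebra.algebraMap_mem _ a, hC a⟩
        | add x y _ _ hx hy =>
          obtain ⟨h1, h1'⟩ := hx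
          obtain ⟨h2, h2'⟩ := hy
          exact ⟨add_mem h1 h2, add_mem h1' h2'⟩
        | mul x y _ _ hx hy =>
          obtain ⟨h1, h1'⟩ := hx
          obtain ⟨h2, h2'⟩ := hy
          exact ⟨mul_mem h1 h2, mul_mem h1' h2'⟩
      intro f hf
      exact (hadj f (by rw [adjoin_monomial_eq_reesAlgebra]; exact hf)).2
    intro z
    obtain ⟨⟨f, hf⟩, rfl⟩ := Ideal.Quotient.mk_surjective z
    exact hrange f hf
  have hker : RingHom.ker θ' = RingHom.ker ψ.toRingHom := by
    ext q
    rw [RingHom.mem_ker, RingHom.mem_ker]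
    change Ideal.Quotient.mk 𝔪R (θ q) = 0 ↔ ψ q = 0
    rw [Ideal.Quotient.eq_zero_iff_mem]
    constructor
    · intro h
      ext1 d
      have h1 := coeff_mem_of_mem_map_reesAlgebra I 𝔪 _ h d
      rw [hθψ] at h1
      have hom := isHomogeneous_coeff_aeval g hg q d
      rw [Polynomial.coeff_zero, ← homogeneousComponent_eq_self hom]
      -- The coefficient of `t ^ d` has degree exactly `d * δ`, whereas `𝔪 * I ^ d` starts in degree
      -- `1 + d * δ`; it is therefore zero.
      refine homogeneousComponent_eq_zero_of_mem_mul (a := 1) (b := d * δ) ?_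
        (homogeneousComponent_eq_zero_of_mem_pow (a := δ) ?_ d) h1 _ (by omega)
      · intro f hf
        exact (homogeneousComponent_of_mem_span (T := Set.range X)
          (by rintro _ ⟨i, rfl⟩; exact isHomogeneous_X _ _) hf).1
      · intro f hf
        exact (homogeneousComponent_of_mem_span (T := Set.range g)
          (by rintro _ ⟨i, rfl⟩; exact hg i) (hI ▸ hf)).1
    · intro h
      have : θ q = 0 := Subtype.ext (by rw [hθψ, h]; rfl)
      rw [this]
      exact zero_mem _
  have e1 := RingHom.quotientKerEquivOfSurjective hsurj
  have e2 := RingHom.quotientKerEquivRange ψ.toRingHom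
  rw [← ringKrullDim_eq_of_ringEquiv e1, hker, ringKrullDim_eq_of_ringEquiv e2]
  rfl

end Fiber

/-- A finite dimensional space of polynomials has a basis dual to evaluation at points outside a
given hypersurface. -/
theorem exists_dual_points {k σ : Type*} [Field k] [Infinite k] (U : Submodule k (MvPolynomial σ k))
    [FiniteDimensional k U] (f : MvPolynomial σ k) (hf : f ≠ 0) :
    ∃ (N : ℕ) (p : Fin N → σ → k) (b : Fin N → MvPolynomial σ k),
      (∀ i, eval (p i) f ≠ 0) ∧ (∀ i, b i ∈ U) ∧ (∀ i, eval (p i) (b i) = 1) ∧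
      (∀ i j, i ≠ j → eval (p i) (b j) = 0) ∧
      ∀ u ∈ U, u = ∑ j, C (eval (p j) u) * b j := by
  classical
  let ev : (σ → k) → Module.Dual k U := fun p => (aeval p).toLinearMap ∘ₗ U.subtype
  have hev : ∀ p u, ev p u = eval p (u : MvPolynomial σ k) := fun p u => by
    simp [ev]
  -- A basis of the span of the evaluation functionals, chosen among evaluations at points where `f`
  -- does not vanish.
  obtain ⟨φ, hφ, hspan, hli⟩ :=
    Submodule.exists_fun_fin_finrank_span_eq k (ev '' {p | eval p f ≠ 0})
  generalize Module.finrank k (Submodule.span k (ev '' {p | eval p f ≠ 0})) = N at φ hφ hspan hli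
  choose p hp hpφ using hφ
  let Φ : U →ₗ[k] (Fin N → k) := LinearMap.pi φ
  have hinj : Function.Injective Φ := by
    rw [injective_iff_map_eq_zero]
    intro u hu
    have h1 : ∀ ψ ∈ Submodule.span k (Set.range φ), ψ u = 0 := by
      intro ψ hψ
      induction hψ using Submodule.span_induction with
      | mem ψ h => obtain ⟨i, rfl⟩ := h; exact congrFun hu i
      | zero => rfl
      | add x y _ _ hx hy => simp [hx, hy]
      | smul a x _ hx => simp [hx]
    -- An element killed by all chosen evaluations vanishes wherever `f` does not, so its product
    -- with `f` vanishes at every point.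
    have h2 : (u : MvPolynomial σ k) * f = 0 := by
      refine MvPolynomial.funext fun x => ?_
      rw [map_mul, map_zero]
      by_cases hx : eval x f = 0
      · rw [hx, mul_zero]
      · rw [← hev, h1 (ev x) (hspan ▸ Submodule.subset_span ⟨x, hx, rfl⟩), zero_mul]
    exact Subtype.ext ((mul_eq_zero.1 h2).resolve_right hf)
  have hN : Module.finrank k U = Module.finrank k (Fin N → k) := by
    apply le_antisymm (LinearMap.finrank_le_finrank_of_injective hinj)
    rw [← Subspace.dual_finrank_eq (K := k) (V := U), Module.finrank_fin_fun]
    simpa using hli.fintype_card_le_finrank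
  let e := LinearEquiv.ofInjectiveOfFinrankEq Φ hinj hN
  have he : ∀ i (u : U), eval (p i) (u : MvPolynomial σ k) = e u i := by
    intro i u
    rw [← hev, hpφ]
    rfl
  refine ⟨N, p, fun j => e.symm (Pi.single j 1), hp, fun j => (e.symm _).2, ?_, ?_, ?_⟩
  · intro i
    simp [he]
  · intro i j hij
    simp [he, hij]
  · intro u hu
    have h1 : (⟨u, hu⟩ : U) = ∑ j, eval (p j) u • e.symm (Pi.single j 1) := by
      apply e.injective
      rw [map_sum]
      simp only [map_smul, LinearEquiv.apply_symm_apply]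
      rw [pi_eq_sum_univ' (e ⟨u, hu⟩)]
      refine Finset.sum_congr rfl fun j _ => ?_
      rw [← he]
    have h2 := congrArg U.subtype h1
    rw [map_sum] at h2
    simpa [smul_eq_C_mul] using h2

/-! ### Homogeneous presentations and row ideals as colon ideals. -/

section Presentation
variable {k : Type*} [Field k] {n : ℕ}

/-- As all `b i` have one degree `D`, the homogeneous components of a syzygy are again syzygies;
those of a finite generating set serve as columns. -/
theorem exists_presentation {N D : ℕ} (b : Fin N → MvPolynomial (Fin (n + 1)) k)
    (hb : ∀ i, (b i).IsHomogeneous D) (hmin : ∀ i, b i ∉ Ideal.span (b '' {j | j ≠ i})) :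
    ∃ (c : ℕ) (A : Matrix (Fin N) (Fin c) (MvPolynomial (Fin (n + 1)) k)),
      IsHomogeneousPresentation (Ideal.span (Set.range b)) b A := by
  classical
  let S := MvPolynomial (Fin (n + 1)) k
  let syz : Submodule S (Fin N → S) := LinearMap.ker (Fintype.linearCombination S b)
  have hsyz : ∀ v, v ∈ syz ↔ ∑ i, v i * b i = 0 := fun v => by
    simp [syz, Fintype.linearCombination_apply]
  obtain ⟨T, hT⟩ := (inferInstance : IsNoetherian S (Fin N → S)).noetherian syz
  let comp : ℕ → (Fin N → S) → (Fin N → S) := fun e v i => homogeneousComponent e (v i)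
  -- `B` exceeds the degree of every entry, so the components of degree below `B` recover each
  -- syzygy.
  let B : ℕ := T.sup (fun v => Finset.univ.sup fun i => (v i).totalDegree) + 1
  let G : Set (Fin N → S) := (fun x : ℕ × (Fin N → S) => comp x.1 x.2) '' ↑(Finset.range B ×ˢ T)
  have hG : G.Finite := (Finset.finite_toSet _).image _
  have hcomp : ∀ e v, v ∈ syz → comp e v ∈ syz := by
    intro e v hv
    rw [hsyz] at hv ⊢
    have := congrArg (homogeneousComponent (D + e)) hv
    rw [map_sum, map_zero] at this
    rw [← this]
    exact Finset.sum_congr rfl fun i _ => (homogeneousComponent_mul_add _ (hb i) e).symm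
  have hspan : Submodule.span S G = syz := by
    apply le_antisymm
    · rw [Submodule.span_le]
      rintro _ ⟨⟨e, v⟩, hev, rfl⟩
      refine hcomp e v ?_
      rw [← hT]
      exact Submodule.subset_span (by simp at hev; exact hev.2)
    · rw [← hT, Submodule.span_le]
      intro v hv
      have hv' : v = ∑ e ∈ Finset.range B, comp e v := by
        ext1 i
        rw [Finset.sum_apply]
        have hdeg : (v i).totalDegree + 1 ≤ B := by
          refine Nat.succ_le_succ ?_
          exact (Finset.le_sup (f := fun i => (v i).totalDegree) (Finset.mem_univ i)).trans
            (Finset.le_sup (f := fun v : Fin N → S =>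
              Finset.univ.sup fun i => (v i).totalDegree) hv)
        rw [← Finset.sum_subset (Finset.range_mono hdeg)]
        · exact (sum_homogeneousComponent _).symm
        · intro e _ he
          refine homogeneousComponent_eq_zero _ _ ?_
          simp at he
          omega
      rw [hv']
      refine Submodule.sum_mem _ fun e he => Submodule.subset_span ⟨(e, v), ?_, rfl⟩
      simp only [Finset.coe_product, Set.mem_prod, Finset.mem_coe]
      exact ⟨he, hv⟩
  obtain ⟨c, col, hcol⟩ := hG.fin_embedding
  have hcolmem : ∀ j, ∃ e v, comp e v = col j := by
    intro j
    obtain ⟨x, -, hx⟩ : col j ∈ G := hcol ▸ ⟨j, rfl⟩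
    exact ⟨_, _, hx⟩
  choose e v hev using hcolmem
  refine ⟨c, .of fun i j => col j i, rfl, hmin, ⟨fun _ => D, fun j => D + e j, hb, ?_⟩, ?_⟩
  · intro i j _
    refine ⟨e j, rfl, ?_⟩
    rw [Matrix.of_apply, ← hev j]
    exact homogeneousComponent_isHomogeneous _ _
  · intro v
    rw [← hsyz, ← hspan, ← hcol]
    rfl

variable {I : Ideal (MvPolynomial (Fin (n + 1)) k)} {m c : ℕ}
  {g : Fin m → MvPolynomial (Fin (n + 1)) k}
  {A : Matrix (Fin m) (Fin c) (MvPolynomial (Fin (n + 1)) k)}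

theorem IsHomogeneousPresentation.column_syzygy (h : IsHomogeneousPresentation I g A) (j : Fin c) :
    ∑ i, A i j * g i = 0 :=
  (h.exact fun i => A i j).2 (Submodule.subset_span ⟨j, rfl⟩)

theorem IsHomogeneousPresentation.sum_mem_generalizedRowIdeal (h : IsHomogeneousPresentation I g A)
    (q : Fin m → k) (v : Fin m → MvPolynomial (Fin (n + 1)) k) (hv : ∑ i, v i * g i = 0) :
    ∑ i, C (q i) * v i ∈ generalizedRowIdeal A q := by
  have hv' := (h.exact v).1 hv
  clear hv
  induction hv' using Submodule.span_induction with
  | mem v hv =>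
    obtain ⟨j, rfl⟩ := hv
    exact Ideal.subset_span ⟨j, rfl⟩
  | zero => simp
  | add x y hx hy ihx ihy =>
    simp only [Pi.add_apply, mul_add, Finset.sum_add_distrib]
    exact add_mem ihx ihy
  | smul a x hx ih =>
    have : ∑ i, C (q i) * (a • x) i = a * ∑ i, C (q i) * x i := by
      rw [Finset.mul_sum]
      exact Finset.sum_congr rfl fun i _ => by simp; ring
    rw [this]
    exact Ideal.mul_mem_left _ _ ih

theorem generalizedRowIdeal_single (i : Fin m) :
    generalizedRowIdeal A (Pi.single i 1) = rowIdeal A i := by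
  classical
  unfold generalizedRowIdeal rowIdeal
  congr 2
  ext1 j
  rw [Finset.sum_eq_single i] <;> simp +contextual

/-- A relation expressing `f * g i` through the other generators is a syzygy with `i`-th coordinate
`f`, and these coordinates form the ideal of the `i`-th row. -/
theorem IsHomogeneousPresentation.mem_rowIdeal_iff (h : IsHomogeneousPresentation I g A)
    (i : Fin m) (f : MvPolynomial (Fin (n + 1)) k) :
    f ∈ rowIdeal A i ↔ f * g i ∈ Ideal.span (g '' {j | j ≠ i}) := by
  classical
  constructor
  · intro hf
    induction hf using Submodule.span_induction with
    | mem f hf =>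
      obtain ⟨j, rfl⟩ := hf
      have h1 := h.column_syzygy j
      rw [← Finset.add_sum_erase _ _ (Finset.mem_univ i)] at h1
      rw [eq_neg_of_add_eq_zero_left h1]
      refine neg_mem (Submodule.sum_mem _ fun l hl => Ideal.mul_mem_left _ _
        (Ideal.subset_span ⟨l, ?_, rfl⟩))
      simpa using hl
    | zero => simp
    | add x y _ _ hx hy => rw [add_mul]; exact add_mem hx hy
    | smul a x _ hx => rw [smul_eq_mul, mul_assoc]; exact Ideal.mul_mem_left _ _ hx
  · intro hf
    obtain ⟨l, hl, hlf⟩ := (Finsupp.mem_span_image_iff_linearCombination _).1 hf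
    have hli : l i = 0 := by
      by_contra hi
      exact (Finsupp.mem_supported _ _).1 hl (Finsupp.mem_support_iff.2 hi) rfl
    have hsyz : ∑ j, (Pi.single i f - ⇑l : Fin m → MvPolynomial (Fin (n + 1)) k) j * g j = 0 := by
      have h1 : ∑ j, l j * g j = f * g i := by
        rw [← hlf, Finsupp.linearCombination_apply, Finsupp.sum_fintype] <;> simp
      simp only [Pi.sub_apply, sub_mul, Finset.sum_sub_distrib, h1]
      rw [Finset.sum_eq_single i] <;> simp +contextual
    have h2 := h.sum_mem_generalizedRowIdeal (Pi.single i 1) _ hsyz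
    rw [generalizedRowIdeal_single, Finset.sum_eq_single i] at h2
    · simpa [hli] using h2
    · simp +contextual
    · simp

/-- All generators have degree at least `δ`. One of larger degree contributes nothing to the forms
of degree `δ`, which generate `I`, so it would be redundant. -/
theorem IsHomogeneousPresentation.isHomogeneous (h : IsHomogeneousPresentation I g A) {δ : ℕ}
    {W : Set (MvPolynomial (Fin (n + 1)) k)} (hW : ∀ w ∈ W, w.IsHomogeneous δ)
    (hI : I = Ideal.span W) (i : Fin m) : (g i).IsHomogeneous δ := by
  obtain ⟨a, -, ha, -⟩ := h.homogeneous
  by_cases hai : a i = δ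
  · exact hai ▸ ha i
  exfalso
  have hgI : ∀ j, g j ∈ Ideal.span W := fun j => by
    rw [← hI, ← h.span_eq]
    exact Ideal.subset_span ⟨j, rfl⟩
  have hg0 : ∀ j, g j ≠ 0 := fun j hj => h.minimal j (hj ▸ zero_mem _)
  have hle : ∀ j, δ ≤ a j := by
    intro j
    by_contra hj
    have h1 := (homogeneousComponent_of_mem_span hW (hgI j)).1 (a j) (by omega)
    rw [homogeneousComponent_eq_self (ha j)] at h1
    exact hg0 j h1
  apply h.minimal i
  have hWJ : Ideal.span W ≤ Ideal.span (g '' {j | j ≠ i}) := by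
    rw [Ideal.span_le]
    intro w hw
    have hwI : w ∈ Ideal.span (Set.range g) := by
      rw [h.span_eq, hI]
      exact Ideal.subset_span hw
    obtain ⟨v, hv⟩ := Ideal.mem_span_range_iff_exists_fun.1 hwI
    rw [SetLike.mem_coe, ← homogeneousComponent_eq_self (hW w hw), ← hv, map_sum]
    refine Submodule.sum_mem _ fun j _ => ?_
    by_cases hj : j = i
    · subst hj
      rw [homogeneousComponent_mul_of_isHomogeneous _ (ha j), if_neg (by have := hle j; omega)]
      exact zero_mem _
    · rw [homogeneousComponent_mul_of_isHomogeneous _ (ha j)]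
      split_ifs
      · exact Ideal.mul_mem_left _ _ (Ideal.subset_span ⟨j, hj, rfl⟩)
      · exact zero_mem _
  exact hWJ (hgI i)

end Presentation

/-! ### The generalized row ideal attached to a point. -/

section Pointwise
variable {k : Type*} [Field k] {n : ℕ}
  {I : Ideal (MvPolynomial (Fin (n + 1)) k)} {m c : ℕ}
  {g : Fin m → MvPolynomial (Fin (n + 1)) k}
  {A : Matrix (Fin m) (Fin c) (MvPolynomial (Fin (n + 1)) k)}
  {p : Fin (n + 1) → k}

/-- Writing one copy of `u` as `∑ a i * g i` turns `u * g i₀ - g i₀ * u = 0` into a syzygy. Combined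
with coefficients `g i (p)`, it gives `u(p) * g i₀ - g i₀ (p) * u`, whose first term vanishes. -/
theorem IsHomogeneousPresentation.mem_generalizedRowIdeal_of_eval_eq_zero
    (h : IsHomogeneousPresentation I g A) (hp : ∃ i, eval p (g i) ≠ 0)
    {u : MvPolynomial (Fin (n + 1)) k} (hu : u ∈ Submodule.span k (Set.range g))
    (hup : eval p u = 0) : u ∈ generalizedRowIdeal A (fun i => eval p (g i)) := by
  classical
  obtain ⟨i₀, hi₀⟩ := hp
  obtain ⟨a, ha⟩ := (Submodule.mem_span_range_iff_exists_fun k).1 hu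
  simp only [smul_eq_C_mul] at ha
  have h1 := h.sum_mem_generalizedRowIdeal (fun i => eval p (g i))
    (fun i => C (a i) * g i₀ - Pi.single (M := fun _ => MvPolynomial (Fin (n + 1)) k) i₀ u i) (by
      have h2 : ∑ i, C (a i) * g i₀ * g i = u * g i₀ := by
        rw [← ha, Finset.sum_mul]
        exact Finset.sum_congr rfl fun i _ => by ring
      simp only [sub_mul, Finset.sum_sub_distrib, h2]
      rw [Finset.sum_eq_single i₀] <;> simp +contextual)
  have h3 : ∑ i, C (eval p (g i)) * (C (a i) * g i₀) = 0 := by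
    rw [← ha, map_sum] at hup
    have h4 := congrArg (fun z => C z * g i₀) hup
    simp only [map_sum, map_mul, eval_C, map_zero, zero_mul, Finset.sum_mul] at h4
    rw [← h4]
    exact Finset.sum_congr rfl fun i _ => by ring
  simp only [mul_sub, Finset.sum_sub_distrib, h3] at h1
  rw [Finset.sum_eq_single i₀ (by simp +contextual) (by simp)] at h1
  simp only [Pi.single_eq_same, zero_sub, neg_mem_iff] at h1
  have h5 := Ideal.mul_mem_left _ (C (eval p (g i₀))⁻¹) h1
  rwa [← mul_assoc, ← C_mul, inv_mul_cancel₀ hi₀, C_1, one_mul] at h5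

/-- For a generator `f = ∑ g i (p) * A i j`, the column syzygy allows subtracting `w(p) * g i`: thus
`f * w = ∑ A i j * (g i (p) * w - w(p) * g i)`, and each bracket vanishes at `p`. -/
theorem IsHomogeneousPresentation.mul_mem_of_mem_generalizedRowIdeal
    (h : IsHomogeneousPresentation I g A) {f : MvPolynomial (Fin (n + 1)) k}
    (hf : f ∈ generalizedRowIdeal A (fun i => eval p (g i)))
    {w : MvPolynomial (Fin (n + 1)) k} (hw : w ∈ Submodule.span k (Set.range g)) :
    f * w ∈ Ideal.span {u | u ∈ Submodule.span k (Set.range g) ∧ eval p u = 0} := by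
  induction hf using Submodule.span_induction with
  | mem f hf =>
    obtain ⟨j, rfl⟩ := hf
    have h1 : (∑ i, C (eval p (g i)) * A i j) * w =
        ∑ i, A i j * (C (eval p (g i)) * w - C (eval p w) * g i) := by
      have h2 : ∑ i, A i j * (C (eval p w) * g i) = 0 := by
        rw [← mul_zero (C (eval p w)), ← h.column_syzygy j, Finset.mul_sum]
        exact Finset.sum_congr rfl fun i _ => by ring
      simp only [mul_sub, Finset.sum_sub_distrib, h2, sub_zero, Finset.sum_mul]
      exact Finset.sum_congr rfl fun i _ => by ring
    change (∑ i, C (eval p (g i)) * A i j) * w ∈ _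
    rw [h1]
    refine Submodule.sum_mem _ fun i _ => Ideal.mul_mem_left _ _ (Ideal.subset_span ⟨?_, ?_⟩)
    · rw [← smul_eq_C_mul, ← smul_eq_C_mul]
      exact sub_mem (Submodule.smul_mem _ _ hw)
        (Submodule.smul_mem _ _ (Submodule.subset_span ⟨i, rfl⟩))
    · simp [mul_comm]
  | zero => simp
  | add x y _ _ hx hy => rw [add_mul]; exact add_mem hx hy
  | smul a x _ hx => rw [smul_eq_mul, mul_assoc]; exact Ideal.mul_mem_left _ _ hx

theorem eval_eq_zero_of_mem_span {σ : Type*} {p : σ → k} {T : Set (MvPolynomial σ k)}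
    (hT : ∀ u ∈ T, eval p u = 0) {f : MvPolynomial σ k} (hf : f ∈ Ideal.span T) :
    eval p f = 0 := by
  have h : Ideal.span T ≤ RingHom.ker (eval p) := Ideal.span_le.2 hT
  exact h hf

theorem IsHomogeneousPresentation.eval_eq_zero_of_mem_generalizedRowIdeal
    (h : IsHomogeneousPresentation I g A) (hp : ∃ i, eval p (g i) ≠ 0)
    {f : MvPolynomial (Fin (n + 1)) k}
    (hf : f ∈ generalizedRowIdeal A (fun i => eval p (g i))) : eval p f = 0 := by
  obtain ⟨i₀, hi₀⟩ := hp
  have h1 := eval_eq_zero_of_mem_span (fun u hu => hu.2)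
    (h.mul_mem_of_mem_generalizedRowIdeal hf (Submodule.subset_span ⟨i₀, rfl⟩))
  rw [map_mul] at h1
  exact (mul_eq_zero.1 h1).resolve_right hi₀

/-- Modulo `J` the space `W` collapses to multiples of `w₀` through evaluation at `p`, and
evaluation is multiplicative. -/
theorem pow_span_sub_mem {J : Ideal (MvPolynomial (Fin (n + 1)) k)}
    {W : Submodule k (MvPolynomial (Fin (n + 1)) k)} {w₀ : MvPolynomial (Fin (n + 1)) k}
    (hJ : ∀ w ∈ W, w - C (eval p w) * w₀ ∈ J) (d : ℕ) :
    ∀ u ∈ W ^ d, u - C (eval p u) * w₀ ^ d ∈ J := by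
  induction d with
  | zero =>
    intro u hu
    rw [pow_zero, Submodule.mem_one] at hu
    obtain ⟨a, rfl⟩ := hu
    simp [algebraMap_eq]
  | succ d ih =>
    intro u hu
    rw [pow_succ] at hu
    induction hu using Submodule.mul_induction_on' with
    | mem_mul_mem x hx y hy =>
      have h1 := ih x hx
      have h2 := hJ y hy
      have h3 := add_mem (Ideal.mul_mem_right y _ h1)
        (Ideal.mul_mem_left _ (C (eval p x) * w₀ ^ d) h2)
      convert h3 using 1
      rw [map_mul, C_mul]
      ring
    | add x _ y _ hx hy =>
      have h3 := add_mem hx hy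
      convert h3 using 1
      rw [map_add, C_add]
      ring

/-- The row ideals of powers, at points where the forms do not all vanish. -/
theorem IsHomogeneousPresentation.mem_generalizedRowIdeal_iff_mul_mem
    (h : IsHomogeneousPresentation I g A) (hp : ∃ i, eval p (g i) ≠ 0)
    (hprime : (generalizedRowIdeal A (fun i => eval p (g i))).IsPrime) {d : ℕ} (hd : 1 ≤ d)
    {b : MvPolynomial (Fin (n + 1)) k} (hb : b ∈ Submodule.span k (Set.range g) ^ d)
    (hbp : eval p b = 1) (f : MvPolynomial (Fin (n + 1)) k) :
    f * b ∈ Ideal.span {u | u ∈ Submodule.span k (Set.range g) ^ d ∧ eval p u = 0} ↔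
      f ∈ generalizedRowIdeal A (fun i => eval p (g i)) := by
  set W := Submodule.span k (Set.range g)
  set J := generalizedRowIdeal A (fun i => eval p (g i))
  constructor
  · intro hf
    obtain ⟨i₀, hi₀⟩ := hp
    let w₀ := C (eval p (g i₀))⁻¹ * g i₀
    have hw₀ : w₀ ∈ W := by
      simp only [w₀]
      rw [← smul_eq_C_mul]
      exact Submodule.smul_mem _ _ (Submodule.subset_span ⟨i₀, rfl⟩)
    have hw₀p : eval p w₀ = 1 := by simp [w₀, hi₀]
    have hpow := pow_span_sub_mem (p := p) (J := J) (W := W) (w₀ := w₀) (fun w hw => by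
      refine h.mem_generalizedRowIdeal_of_eval_eq_zero ⟨i₀, hi₀⟩ ?_ (by simp [hw₀p])
      rw [← smul_eq_C_mul]
      exact sub_mem hw (Submodule.smul_mem _ _ hw₀)) d
    have hle : Ideal.span {u | u ∈ W ^ d ∧ eval p u = 0} ≤ J := by
      rw [Ideal.span_le]
      rintro u ⟨hu, hu0⟩
      simpa [hu0] using hpow u hu
    -- Elements of `J` vanish at `p` and `b(p) = 1`, so `b ∉ J` and primality puts `f` in `J`.
    refine (hprime.mem_or_mem (hle hf)).resolve_right fun hbJ => ?_
    have := h.eval_eq_zero_of_mem_generalizedRowIdeal ⟨i₀, hi₀⟩ hbJ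
    rw [hbp] at this
    exact one_ne_zero this
  · intro hf
    clear hbp
    obtain ⟨d, rfl⟩ : ∃ e, d = e + 1 := ⟨d - 1, by omega⟩
    -- One factor of `b` in `W` already carries `f` into the ideal of forms of `W` vanishing at `p`;
    -- the other factors keep the vanishing.
    rw [pow_succ'] at hb
    induction hb using Submodule.mul_induction_on' with
    | mem_mul_mem x hx y hy =>
      have h1 := h.mul_mem_of_mem_generalizedRowIdeal hf hx
      rw [← mul_assoc]
      generalize f * x = z at h1
      induction h1 using Submodule.span_induction with
      | mem z hz =>
        refine Ideal.subset_span ⟨?_, by rw [map_mul, hz.2, zero_mul]⟩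
        rw [pow_succ']
        exact Submodule.mul_mem_mul hz.1 hy
      | zero => simp
      | add z z' _ _ hz hz' => rw [add_mul]; exact add_mem hz hz'
      | smul a z _ hz => rw [smul_eq_mul, mul_assoc]; exact Ideal.mul_mem_left _ _ hz
    | add x _ y _ hx hy => rw [mul_add]; exact add_mem hx hy

end Pointwise

theorem ideal_span_pow_eq {k S : Type*} [Field k] [CommRing S] [Algebra k S] (W : Submodule k S)
    (d : ℕ) :
    Ideal.span (W : Set S) ^ d = Ideal.span ((W ^ d : Submodule k S) : Set S) := by
  induction d with
  | zero =>
    rw [pow_zero, pow_zero, eq_comm, Ideal.one_eq_top, Ideal.eq_top_iff_one]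
    exact Ideal.subset_span (Submodule.one_le.1 le_rfl)
  | succ d ih =>
    rw [pow_succ, ih, Ideal.span_mul_span']
    apply le_antisymm
    · rw [Ideal.span_le]
      rintro _ ⟨x, hx, y, hy, rfl⟩
      exact Ideal.subset_span (by rw [pow_succ]; exact Submodule.mul_mem_mul hx hy)
    · rw [Ideal.span_le]
      intro u hu
      rw [SetLike.mem_coe, pow_succ] at hu
      induction hu using Submodule.mul_induction_on' with
      | mem_mul_mem x hx y hy => exact Ideal.subset_span ⟨x, hx, y, hy, rfl⟩
      | add x _ y _ hx hy => exact add_mem hx hy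

theorem isHomogeneous_of_mem_pow {k σ : Type*} [Field k]
    {W : Submodule k (MvPolynomial σ k)} {δ : ℕ} (hW : W ≤ homogeneousSubmodule σ k δ) (d : ℕ) :
    W ^ d ≤ homogeneousSubmodule σ k (d * δ) := by
  induction d with
  | zero =>
    rw [pow_zero, Submodule.one_le, zero_mul]
    exact isHomogeneous_one σ k
  | succ d ih =>
    rw [pow_succ, Submodule.mul_le]
    intro x hx y hy
    rw [Nat.succ_mul]
    exact IsHomogeneous.mul (ih hx) (hW hy)

/-! ### Linear parts of generalized rows and the height at a general point. -/

section Main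
variable {k : Type*} [Field k] {n : ℕ}
  {I : Ideal (MvPolynomial (Fin (n + 1)) k)} {m c : ℕ}
  {g : Fin m → MvPolynomial (Fin (n + 1)) k}
  {A : Matrix (Fin m) (Fin c) (MvPolynomial (Fin (n + 1)) k)}

theorem linCoeff_sum_C_mul {σ ι : Type*} (s : Finset ι) (q : ι → k) (f : ι → MvPolynomial σ k)
    (l : σ) : linCoeff (∑ i ∈ s, C (q i) * f i) l = ∑ i ∈ s, q i * linCoeff (f i) l := by
  simp [linCoeff, coeff_sum, coeff_C_mul]

/-- The bilinear forms whose values at a point are the linear parts of the generalized row. -/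
noncomputable def linearPartMatrix (g : Fin m → MvPolynomial (Fin (n + 1)) k)
    (A : Matrix (Fin m) (Fin c) (MvPolynomial (Fin (n + 1)) k)) :
    Matrix (Fin c) (Fin (n + 1)) (MvPolynomial (Fin (n + 1)) k) :=
  .of fun j l => ∑ i, C (linCoeff (A i j) l) * g i

theorem linearPartMatrix_map_eval (p : Fin (n + 1) → k) (j : Fin c) :
    (linearPartMatrix g A).map (eval p) j = linCoeff (∑ i, C (eval p (g i)) * A i j) := by
  ext1 l
  rw [linCoeff_sum_C_mul]
  simp [linearPartMatrix, mul_comm]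

/-- This is the degree `δ + 1` component of a column syzygy: the linear parts of the entries satisfy
the same relation. -/
theorem IsHomogeneousPresentation.sum_linearPartMatrix_mul_X {δ : ℕ}
    (h : IsHomogeneousPresentation I g A) (hg : ∀ i, (g i).IsHomogeneous δ) (j : Fin c) :
    ∑ l, linearPartMatrix g A j l * X l = 0 := by
  have h1 := congrArg (homogeneousComponent (δ + 1)) (h.column_syzygy j)
  rw [map_sum, map_zero] at h1
  rw [← h1]
  simp only [linearPartMatrix, Matrix.of_apply, Finset.sum_mul]
  rw [Finset.sum_comm]
  refine Finset.sum_congr rfl fun i _ => ?_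
  rw [homogeneousComponent_mul_add _ (hg i), homogeneousComponent_one_eq_linForm, linForm_apply,
    Finset.sum_mul]
  exact Finset.sum_congr rfl fun l _ => by ring

theorem generalizedRowIdeal_eq_span_linForm (p : Fin (n + 1) → k)
    (hlin : IsLinearIdeal (generalizedRowIdeal A (fun i => eval p (g i)))) :
    generalizedRowIdeal A (fun i => eval p (g i)) =
      Ideal.span (linForm k (Fin (n + 1)) ''
        (Submodule.span k (Set.range ((linearPartMatrix g A).map (eval p)).row))) := by
  obtain ⟨T, hT, hJ⟩ := hlin
  have h1 := linear_span_eq_span_linForm hT hJ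
  rw [← hJ, ← Set.range_comp] at h1
  rw [h1]
  congr 5
  ext1 j
  exact (linearPartMatrix_map_eval p j).symm

theorem IsLinearlyPresented.hasLinearGeneralizedRowIdeals (h : IsLinearlyPresented I) :
    HasLinearGeneralizedRowIdeals I := by
  obtain ⟨m, c, g, A, hA, hlin⟩ := h
  refine ⟨m, c, g, A, hA, fun q _ => ⟨_, ?_, rfl⟩⟩
  rintro _ ⟨j, rfl⟩
  exact IsHomogeneous.sum _ _ _ fun i _ => by
    have := (isHomogeneous_C (Fin (n + 1)) (q i)).mul (hlin i j)
    rwa [zero_add] at this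

open Matrix in
theorem IsHomogeneousPresentation.exists_generic_height [Infinite k] {δ : ℕ}
    (h : IsHomogeneousPresentation I g A) (hg : ∀ i, (g i).IsHomogeneous δ)
    (hlin : ∀ q : Fin m → k, q ≠ 0 → IsLinearIdeal (generalizedRowIdeal A q)) (hI : I ≠ ⊥) :
    ∃ f : MvPolynomial (Fin (n + 1)) k, f ≠ 0 ∧ ∀ p, eval p f ≠ 0 →
      (∃ i, eval p (g i) ≠ 0) ∧
      ((generalizedRowIdeal A (fun i => eval p (g i))).height : WithBot ℕ∞) + 1 =
        analyticSpread I := by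
  have hq : ∀ p, (∃ i, eval p (g i) ≠ 0) →
      IsLinearIdeal (generalizedRowIdeal A (fun i => eval p (g i))) := by
    rintro p ⟨i, hi⟩
    exact hlin _ fun h0 => hi (congrFun h0 i)
  have hne : ∃ p i, eval p (g i) ≠ 0 := by
    by_contra! hall
    apply hI
    rw [← h.span_eq, Ideal.span_eq_bot]
    rintro _ ⟨i, rfl⟩
    exact MvPolynomial.funext fun p => by rw [hall p i, map_zero]
  obtain ⟨r, f, hf0, hf, htr⟩ := exists_generic_rank g hg (linearPartMatrix g A) (fun j l => by
      change ∑ i, C (linCoeff (A i j) l) * g i ∈ _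
      refine Submodule.sum_mem _ fun i _ => ?_
      rw [← smul_eq_C_mul]
      exact Submodule.smul_mem _ _ (Submodule.subset_span ⟨i, rfl⟩))
    (h.sum_linearPartMatrix_mul_X hg) (fun p y hp hy i j => by
      -- The fibre condition: this combination vanishes at `p`, so it lies in the generalized row
      -- ideal, whose linear generators all vanish at a `y` in the kernel.
      have h1 : C (eval p (g j)) * g i - C (eval p (g i)) * g j ∈
          generalizedRowIdeal A (fun i => eval p (g i)) := by
        refine h.mem_generalizedRowIdeal_of_eval_eq_zero hp ?_ (by simp [mul_comm])
        rw [← smul_eq_C_mul, ← smul_eq_C_mul]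
        exact sub_mem (Submodule.smul_mem _ _ (Submodule.subset_span ⟨_, rfl⟩))
          (Submodule.smul_mem _ _ (Submodule.subset_span ⟨_, rfl⟩))
      rw [generalizedRowIdeal_eq_span_linForm p (hq p hp)] at h1
      have h2 := eval_eq_zero_of_mem_span (p := y) ?_ h1
      · simp only [map_sub, map_mul, eval_C] at h2
        linear_combination h2
      · rintro _ ⟨v, hv, rfl⟩
        rw [SetLike.mem_coe] at hv
        rw [eval_linForm]
        induction hv using Submodule.span_induction with
        | mem v hv =>
          obtain ⟨j, rfl⟩ := hv
          exact congrFun hy j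
        | zero => simp
        | add a b _ _ ha hb => simp [add_mul, Finset.sum_add_distrib, ha, hb]
        | smul a b _ hb => simp [mul_assoc, ← Finset.mul_sum, hb]) hne
  refine ⟨f, hf0, fun p hp => ⟨(hf p hp).1, ?_⟩⟩
  obtain ⟨hp1, hp2⟩ := hf p hp
  have hht := (isPrime_and_height_span_linForm (Submodule.span k
    (Set.range ((linearPartMatrix g A).map (eval p)).row))).2
  rw [← rank_eq_finrank_span_row, hp2] at hht
  rw [generalizedRowIdeal_eq_span_linForm p (hq p hp1), hht]
  have hft := Algebra.FiniteType.of_surjective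
    (aeval (fun i => Polynomial.C (g i) * Polynomial.X) : MvPolynomial (Fin m) k →ₐ[k]
      Polynomial (MvPolynomial (Fin (n + 1)) k)).rangeRestrict (AlgHom.rangeRestrict_surjective _)
  obtain ⟨s, hs1, hs2⟩ := exists_ringKrullDim_eq_trdeg k
    (aeval (fun i => Polynomial.C (g i) * Polynomial.X) : MvPolynomial (Fin m) k →ₐ[k]
      Polynomial (MvPolynomial (Fin (n + 1)) k)).range
  rw [analyticSpread, ringKrullDim_fiber g hg I h.span_eq, hs1, htr s hs2]
  norm_cast

end Main
end RowIdeals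

/-! ### The presentation of the power by a basis dual to general points. -/

theorem mainTheorem6 {k : Type*} [Field k] [Infinite k] (n δ : ℕ)
    (W : Submodule k (MvPolynomial (Fin (n + 1)) k))
    (hW : W ≤ MvPolynomial.homogeneousSubmodule (Fin (n + 1)) k δ)
    (I : Ideal (MvPolynomial (Fin (n + 1)) k))
    (hI : I = Ideal.span (W : Set (MvPolynomial (Fin (n + 1)) k)))
    (hcodim : 2 ≤ I.height)
    (hlin : RowIdeals.IsLinearlyPresented I ∨ RowIdeals.HasLinearGeneralizedRowIdeals I)
    (d : ℕ) (hd : 1 ≤ d) :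
    ∃ (m c : ℕ) (g : Fin m → MvPolynomial (Fin (n + 1)) k)
      (A : Matrix (Fin m) (Fin c) (MvPolynomial (Fin (n + 1)) k)),
      RowIdeals.IsHomogeneousPresentation (I ^ d) g A ∧
        ∀ i : Fin m, RowIdeals.IsLinearIdeal (RowIdeals.rowIdeal A i) ∧
          ((RowIdeals.rowIdeal A i).height : WithBot ℕ∞) + 1 = RowIdeals.analyticSpread I := by
  have hI0 : I ≠ ⊥ := by
    rintro rfl
    rw [Ideal.height_bot] at hcodim
    exact absurd hcodim (by decide)
  obtain ⟨m, c, g, A, hA, hlin⟩ :=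
    hlin.elim RowIdeals.IsLinearlyPresented.hasLinearGeneralizedRowIdeals id
  have hg : ∀ i, (g i).IsHomogeneous δ := hA.isHomogeneous (fun w hw => hW hw) hI
  obtain ⟨f, hf0, hf⟩ := hA.exists_generic_height hg hlin hI0
  let V := Submodule.span k (Set.range g)
  have hV : V ≤ MvPolynomial.homogeneousSubmodule (Fin (n + 1)) k δ := by
    rw [Submodule.span_le]
    rintro _ ⟨i, rfl⟩
    exact hg i
  have hVd := RowIdeals.isHomogeneous_of_mem_pow hV d
  have hVI : Ideal.span (V : Set (MvPolynomial (Fin (n + 1)) k)) = I := by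
    rw [← hA.span_eq]
    exact Submodule.span_span_of_tower k _ _
  have hfin : FiniteDimensional k (V ^ d : Submodule k (MvPolynomial (Fin (n + 1)) k)) :=
    Module.Finite.iff_fg.2 ((Submodule.fg_span (Set.finite_range g)).pow d)
  -- Avoiding the zeros of `f` gives the generalized row ideal at each `p i` the expected height.
  obtain ⟨N, p, b, hpf, hbV, hb1, hb0, hbasis⟩ := RowIdeals.exists_dual_points (V ^ d) f hf0
  have hmin : ∀ i, b i ∉ Ideal.span (b '' {j | j ≠ i}) := by
    intro i hi
    have h1 := RowIdeals.eval_eq_zero_of_mem_span (p := p i) (by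
      rintro _ ⟨j, hj, rfl⟩
      exact hb0 i j (Ne.symm hj)) hi
    rw [hb1] at h1
    exact one_ne_zero h1
  obtain ⟨c', B, hB⟩ := RowIdeals.exists_presentation b (fun i => hVd (hbV i)) hmin
  have hId : Ideal.span (Set.range b) = I ^ d := by
    rw [← hVI, RowIdeals.ideal_span_pow_eq]
    apply le_antisymm
    · refine Ideal.span_mono ?_
      rintro _ ⟨i, rfl⟩
      exact hbV i
    · rw [Ideal.span_le]
      intro u hu
      rw [SetLike.mem_coe, hbasis u hu]
      exact Submodule.sum_mem _ fun j _ => Ideal.mul_mem_left _ _ (Ideal.subset_span ⟨j, rfl⟩)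
  rw [hId] at hB
  refine ⟨N, c', b, B, hB, fun i => ?_⟩
  obtain ⟨hpi, hht⟩ := hf (p i) (hpf i)
  have hlini : RowIdeals.IsLinearIdeal
      (RowIdeals.generalizedRowIdeal A fun j => MvPolynomial.eval (p i) (g j)) := by
    obtain ⟨j, hj⟩ := hpi
    exact hlin _ fun h0 => hj (congrFun h0 j)
  have hprime : (RowIdeals.generalizedRowIdeal A fun j =>
      MvPolynomial.eval (p i) (g j)).IsPrime := by
    obtain ⟨T, hT, hJ⟩ := hlini
    rw [hJ]
    exact RowIdeals.isPrime_span_of_isHomogeneous_one hT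
  have hrow : RowIdeals.rowIdeal B i =
      RowIdeals.generalizedRowIdeal A fun j => MvPolynomial.eval (p i) (g j) := by
    ext x
    rw [hB.mem_rowIdeal_iff, ← hA.mem_generalizedRowIdeal_iff_mul_mem hpi hprime hd (hbV i) (hb1 i)]
    -- By duality the basis elements other than `b i` span exactly the forms of `V ^ d` vanishing at
    -- `p i`, so the two colon ideals agree.
    suffices h : Ideal.span (b '' {j | j ≠ i}) =
        Ideal.span {u | u ∈ V ^ d ∧ MvPolynomial.eval (p i) u = 0} by rw [h]
    apply le_antisymm
    · refine Ideal.span_mono ?_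
      rintro _ ⟨j, hj, rfl⟩
      exact ⟨hbV j, hb0 i j (Ne.symm hj)⟩
    · rw [Ideal.span_le]
      rintro u ⟨hu, hu0⟩
      rw [SetLike.mem_coe, hbasis u hu]
      refine Submodule.sum_mem _ fun j _ => ?_
      by_cases hj : j = i
      · rw [hj, hu0, MvPolynomial.C_0, zero_mul]
        exact zero_mem _
      · exact Ideal.mul_mem_left _ _ (Ideal.subset_span ⟨j, hj, rfl⟩)
  rw [hrow]
  exact ⟨hlini, hht⟩
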